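/- Let $\mathbb D$ and $\mathbb T$ be the open unit disc and the unit circle in $\mathbb C$, and let $dA$ be normalized Lebesgue area measure on $\mathbb D$. For a finite positive Borel measure $\mu$ on $\overline{\mathbb D}$ put $$U_\mu(w)=\int_{\mathbb D}\log\left|\frac{1-\overline{\zeta}w}{w-\zeta}\right|^2\frac{d\mu(\zeta)}{1-|\zeta|^2}+\int_{\mathbb T}\frac{1-|w|^2}{|\zeta-w|^2}\,d\mu(\zeta),\qquad w\in\mathbb D.$$ For finite positive Borel measures $\mu_1,\mu_2$ on $\overline{\mathbb D}$ and a holomorphic function $f$ on $\mathbb D^2$ put $$\mathcal D_{\mu_1,\mu_2}(f)=\sup_{0<r<1}\int_0^{2\pi}\!\int_{\mathbb D}|\partial_1 f(z_1,re^{i\theta})|^2U_{\mu_1}(z_1)\,dA(z_1)\frac{d\theta}{2\pi}+\sup_{0<r<1}\int_0^{2\pi}\!\int_{\mathbb D}|\partial_2 f(re^{i\theta},z_2)|^2U_{\mu_2}(z_2)\,dA(z_2)\frac{d\theta}{2\pi}.$$ Let $H^2(\mathbb D^2)$ be the Hardy space of the bidisc, i.e. the space of holomorphic $f$ on $\mathbb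 D^2$ with $$\|f\|^2_{H^2(\mathbb D^2)}=\sup_{0<r<1}\int_0^{2\pi}\!\int_0^{2\pi}|f(re^{i\theta_1},re^{i\theta_2})|^2\frac{d\theta_2}{2\pi}\frac{d\theta_1}{2\pi}<\infty,$$ and let $\mathcal D(\mu_1,\mu_2)=\{f\in H^2(\mathbb D^2):\mathcal D_{\mu_1,\mu_2}(f)<\infty\}$ with the norm given by $\|f\|^2=\|f\|^2_{H^2(\mathbb D^2)}+\mathcal D_{\mu_1,\mu_2}(f)$. Then for all finite positive Borel measures $\mu_1,\mu_2$ on $\overline{\mathbb D}$, every polynomial in $z_1,z_2$ with complex coefficients belongs to $\mathcal D(\mu_1,\mu_2)$, and the polynomials are dense in $\mathcal D(\mu_1,\mu_2)$: for every $f\in\mathcal D(\mu_1,\mu_2)$ and every $\varepsilon>0$ there is a polynomial $p$ with $\|f-p\|<\varepsilon$. -/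

import Mathlib

open MeasureTheory Set
open scoped ENNReal

noncomputable section

namespace BidiscDirichlet

/-- The open unit bidisc, as a subset of `ℂ × ℂ`. -/
def bidisc : Set (ℂ × ℂ) := Metric.ball (0 : ℂ) 1 ×ˢ Metric.ball (0 : ℂ) 1

/-- Normalized Lebesgue area measure on the open unit disc. -/
def areaMeasure : Measure ℂ :=
  (ENNReal.ofReal Real.pi)⁻¹ • volume.restrict (Metric.ball (0 : ℂ) 1)

/-- The measure `dθ / 2π` on `[0, 2π]`. -/
def arcMeasure : Measure ℝ :=
  (ENNReal.ofReal (2 * Real.pi))⁻¹ • volume.restrict (Icc 0 (2 * Real.pi))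

/-- The kernel `log |(1 - conj ζ * w) / (w - ζ)|² / (1 - |ζ|²)` for `ζ`, `w` in the open disc;
it is `+∞` on the diagonal. -/
def greenKernel (ζ w : ℂ) : ℝ≥0∞ :=
  open Classical in
  if w = ζ then ⊤
  else ENNReal.ofReal
    (Real.log (‖(1 - (starRingEnd ℂ) ζ * w) / (w - ζ)‖ ^ 2) / (1 - ‖ζ‖ ^ 2))

/-- The Poisson kernel `(1 - |w|²) / |ζ - w|²` for `|ζ| = 1` and `w` in the open disc. -/
def poissonKernel (ζ w : ℂ) : ℝ≥0∞ :=
  ENNReal.ofReal ((1 - ‖w‖ ^ 2) / ‖ζ - w‖ ^ 2)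

/-- The superharmonic weight `U_μ` on the open disc of a measure `μ` on the closed disc. -/
def weight (μ : Measure (Metric.closedBall (0 : ℂ) 1)) (w : ℂ) : ℝ≥0∞ :=
  (∫⁻ ζ in {ζ : Metric.closedBall (0 : ℂ) 1 | ‖(ζ : ℂ)‖ < 1}, greenKernel ζ w ∂μ) +
    ∫⁻ ζ in {ζ : Metric.closedBall (0 : ℂ) 1 | ‖(ζ : ℂ)‖ = 1}, poissonKernel ζ w ∂μ

/-- The complex partial derivative with respect to the first variable. -/
def partial₁ (f : ℂ × ℂ → ℂ) (z : ℂ × ℂ) : ℂ := deriv (fun w => f (w, z.2)) z.1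

/-- The complex partial derivative with respect to the second variable. -/
def partial₂ (f : ℂ × ℂ → ℂ) (z : ℂ × ℂ) : ℂ := deriv (fun w => f (z.1, w)) z.2

/-- The Dirichlet integral `D_{μ₁,μ₂}(f)`; here `circleMap 0 r θ = r * exp (i θ)`. -/
def dirichletIntegral (μ₁ μ₂ : Measure (Metric.closedBall (0 : ℂ) 1)) (f : ℂ × ℂ → ℂ) : ℝ≥0∞ :=
  (⨆ r ∈ Ioo (0 : ℝ) 1, ∫⁻ θ, ∫⁻ z₁, ‖partial₁ f (z₁, circleMap 0 r θ)‖ₑ ^ 2 * weight μ₁ z₁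
      ∂areaMeasure ∂arcMeasure) +
    ⨆ r ∈ Ioo (0 : ℝ) 1, ∫⁻ θ, ∫⁻ z₂, ‖partial₂ f (circleMap 0 r θ, z₂)‖ₑ ^ 2 * weight μ₂ z₂
      ∂areaMeasure ∂arcMeasure

/-- The square of the norm of the Hardy space `H²` of the bidisc (infinite outside `H²`). -/
def hardyNormSq (f : ℂ × ℂ → ℂ) : ℝ≥0∞ :=
  ⨆ r ∈ Ioo (0 : ℝ) 1, ∫⁻ θ₁, ∫⁻ θ₂, ‖f (circleMap 0 r θ₁, circleMap 0 r θ₂)‖ₑ ^ 2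
    ∂arcMeasure ∂arcMeasure

/-- The Hardy space `H²` of the bidisc. Its elements are functions on the bidisc; they are
represented by functions on `ℂ × ℂ`, whose values off the bidisc play no role. -/
def hardySpace : Set (ℂ × ℂ → ℂ) :=
  {f | DifferentiableOn ℂ f bidisc ∧ hardyNormSq f < ⊤}

/-- The Dirichlet-type space `D(μ₁, μ₂)`. -/
def dirichletSpace (μ₁ μ₂ : Measure (Metric.closedBall (0 : ℂ) 1)) : Set (ℂ × ℂ → ℂ) :=
  {f | f ∈ hardySpace ∧ dirichletIntegral μ₁ μ₂ f < ⊤}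

/-- The norm of `D(μ₁, μ₂)`: `‖f‖² = ‖f‖²_{H²} + D_{μ₁,μ₂}(f)`. -/
def dirichletNorm (μ₁ μ₂ : Measure (Metric.closedBall (0 : ℂ) 1)) (f : ℂ × ℂ → ℂ) : ℝ≥0∞ :=
  (hardyNormSq f + dirichletIntegral μ₁ μ₂ f) ^ (1 / 2 : ℝ)

/-- The function `(z₁, z₂) ↦ p(z₁, z₂)` of a polynomial `p` in two variables. -/
def polyFun (p : MvPolynomial (Fin 2) ℂ) : ℂ × ℂ → ℂ :=
  fun z => MvPolynomial.eval ![z.1, z.2] p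

end BidiscDirichlet

end

/-! The approximants are dilates `f_r(z) = f(rz)`. They are holomorphic beyond the closed bidisc, so
Taylor polynomials approximate them and their first derivatives uniformly on the bidisc. As the
weights are integrable (`lintegral_weight_lt_top`), this is approximation in norm, so everything
rests on `f_r → f` in norm as `r → 1`.

The squared norm is a sum of three terms, each a supremum over `R` of `∫ |G|² dm_R` with `G = f`,
`∂₁f` or `∂₂f`. These means increase with `R`, so the supremum satisfies the parallelogram law. If
`H n → G` pointwise and no `H n` has larger supremum than `G`, then Fatou bounds `G + H n` from
below and the parallelogram law forces `G - H n → 0` (`IsMeanFamily.eventually_quad_sub_le`). It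
remains to see that dilation does not increase any of the three terms.

For the Hardy term this is a change of radius. For the others it is a one-variable statement about
`∫ |g|² U_μ dA` (`lintegral_weight_dilate_le`), and Tonelli reduces it to a single kernel `k`, Green
or Poisson. On almost every circle of radius `ρ`, `k` equals a harmonic function `h` with `h ≤ k`
inside. With `q = √r`, the Poisson inequality for `|g|²` passes from radius `q²ρ` out to `qρ`; by
Tonelli and symmetry the same Poisson kernel then acts on the weight, and takes `h` on radius `ρ` to
`h ≤ k` on radius `qρ` (`lintegral_circle_dilate_le`). Integration in `ρ` finishes the comparison.
-/

open Metric Filter Topology InnerProductSpace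

noncomputable section

namespace BidiscDirichlet

/-! ### Separately holomorphic functions and their partial derivatives -/

/-- Separately holomorphic functions on the bidisc that are bounded on smaller closed bidiscs. -/
structure SepHol (f : ℂ × ℂ → ℂ) : Prop where
  left : ∀ b ∈ ball (0 : ℂ) 1, DifferentiableOn ℂ (fun w => f (w, b)) (ball 0 1)
  right : ∀ a ∈ ball (0 : ℂ) 1, DifferentiableOn ℂ (fun w => f (a, w)) (ball 0 1)
  bdd : ∀ R < (1 : ℝ), ∃ M, ∀ a b : ℂ, ‖a‖ ≤ R → ‖b‖ ≤ R → ‖f (a, b)‖ ≤ M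

/-- The class is preserved by swapping variables, dilation and partial differentiation, all by
one-variable arguments; this is why it replaces joint differentiability from here on. -/
theorem sepHol_of_differentiableOn {f : ℂ × ℂ → ℂ} (hf : DifferentiableOn ℂ f bidisc) :
    SepHol f where
  left b hb := hf.comp (f := fun w : ℂ => (w, b)) (by fun_prop) fun w hw => ⟨hw, hb⟩
  right a ha := hf.comp (f := fun w : ℂ => (a, w)) (by fun_prop) fun w hw => ⟨ha, hw⟩
  bdd R hR := by
    obtain ⟨M, hM⟩ := ((isCompact_closedBall (0 : ℂ) R).prod
      (isCompact_closedBall (0 : ℂ) R)).exists_bound_of_continuousOn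
      (hf.continuousOn.mono (prod_mono (closedBall_subset_ball hR) (closedBall_subset_ball hR)))
    exact ⟨M, fun a b ha hb => hM (a, b) (by simp [ha, hb])⟩

theorem SepHol.swap {f : ℂ × ℂ → ℂ} (hf : SepHol f) : SepHol (fun z => f z.swap) where
  left := hf.right
  right := hf.left
  bdd R hR := (hf.bdd R hR).imp fun _ h a b ha hb => h b a hb ha

theorem SepHol.add {f g : ℂ × ℂ → ℂ} (hf : SepHol f) (hg : SepHol g) : SepHol (f + g) where
  left b hb := (hf.left b hb).add (hg.left b hb)
  right b hb := (hf.right b hb).add (hg.right b hb)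
  bdd R hR := by
    obtain ⟨M, hM⟩ := hf.bdd R hR
    obtain ⟨N, hN⟩ := hg.bdd R hR
    exact ⟨M + N, fun a b ha hb => (norm_add_le _ _).trans (add_le_add (hM a b ha hb) (hN a b ha hb))⟩

theorem SepHol.const_mul {f : ℂ × ℂ → ℂ} (hf : SepHol f) (c : ℂ) :
    SepHol (fun z => c * f z) where
  left b hb := (hf.left b hb).const_mul c
  right b hb := (hf.right b hb).const_mul c
  bdd R hR := by
    obtain ⟨M, hM⟩ := hf.bdd R hR
    refine ⟨‖c‖ * M, fun a b ha hb => ?_⟩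
    rw [norm_mul]
    exact mul_le_mul_of_nonneg_left (hM a b ha hb) (norm_nonneg c)

theorem SepHol.sub {f g : ℂ × ℂ → ℂ} (hf : SepHol f) (hg : SepHol g) : SepHol (f - g) := by
  have : f - g = f + fun z => (-1) * g z := by ext z; simp [sub_eq_add_neg]
  rw [this]
  exact hf.add (hg.const_mul _)

/-- The dilation `z ↦ f (r z)`. -/
def dilate (r : ℝ) (f : ℂ × ℂ → ℂ) (z : ℂ × ℂ) : ℂ := f (r * z.1, r * z.2)

theorem norm_ofReal_mul_lt_one {r : ℝ} (h0 : 0 ≤ r) (h1 : r ≤ 1) {w : ℂ} (hw : ‖w‖ < 1) :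
    ‖(r : ℂ) * w‖ < 1 := by
  rw [norm_mul, Complex.norm_of_nonneg h0]
  nlinarith [norm_nonneg w]

theorem SepHol.dilate {f : ℂ × ℂ → ℂ} (hf : SepHol f) {r : ℝ} (h0 : 0 ≤ r) (h1 : r ≤ 1) :
    SepHol (dilate r f) where
  left b hb := by
    refine (hf.left (r * b) ?_).comp (f := fun w : ℂ => r * w) (by fun_prop) fun w hw => ?_
    · simpa using norm_ofReal_mul_lt_one h0 h1 (mem_ball_zero_iff.1 hb)
    · simpa using norm_ofReal_mul_lt_one h0 h1 (mem_ball_zero_iff.1 hw)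
  right b hb := by
    refine (hf.right (r * b) ?_).comp (f := fun w : ℂ => r * w) (by fun_prop) fun w hw => ?_
    · simpa using norm_ofReal_mul_lt_one h0 h1 (mem_ball_zero_iff.1 hb)
    · simpa using norm_ofReal_mul_lt_one h0 h1 (mem_ball_zero_iff.1 hw)
  bdd R hR := by
    obtain ⟨M, hM⟩ := hf.bdd R hR
    have aux : ∀ w : ℂ, ‖w‖ ≤ R → ‖(r : ℂ) * w‖ ≤ R := fun w hw => by
      rw [norm_mul, Complex.norm_of_nonneg h0]
      nlinarith [norm_nonneg w]
    exact ⟨M, fun a b ha hb => hM _ _ (aux a ha) (aux b hb)⟩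

/-- Second-order Schwarz lemma: after removal of its linear part at `c`, `φ` oscillates by at most
`4 * M` and vanishes to second order. The bound depends on `φ` only through `M`, hence is uniform in
a parameter. -/
theorem norm_slope_sub_deriv_le {φ : ℂ → ℂ} {c h : ℂ} {δ M : ℝ}
    (hφ : DifferentiableOn ℂ φ (ball c δ)) (hM : ∀ w ∈ ball c δ, ‖φ w‖ ≤ M)
    (h0 : h ≠ 0) (hh : ‖h‖ < δ) :
    ‖(φ (c + h) - φ c) / h - deriv φ c‖ ≤ 4 * M / δ ^ 2 * ‖h‖ := by
  have hδ : 0 < δ := (norm_nonneg h).trans_lt hh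
  have hc : c ∈ ball c δ := mem_ball_self hδ
  have hmaps : MapsTo φ (ball c δ) (closedBall (φ c) (2 * M)) := fun w hw => by
    rw [mem_closedBall, dist_eq_norm]
    linarith [norm_sub_le (φ w) (φ c), hM w hw, hM c hc]
  have hM0 : 0 ≤ M := (norm_nonneg _).trans (hM c hc)
  have hd := Complex.norm_deriv_le_div_of_mapsTo_ball hφ hmaps hδ
  have hdφ : HasDerivAt φ (deriv φ c) c :=
    (hφ.differentiableAt (isOpen_ball.mem_nhds hc)).hasDerivAt
  set ψ : ℂ → ℂ := fun w => φ w - deriv φ c * (w - c) with hψ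
  have key : dist (ψ (c + h)) (ψ c) ≤ 4 * M * (dist (c + h) c / δ) ^ (1 + 1) := by
    refine Complex.dist_le_mul_div_pow_of_mapsTo_ball_of_isLittleO (f := ψ)
      (hφ.sub (by fun_prop)) ?_ ?_ (by simpa using hh)
    · intro w hw
      have h1 : ‖w - c‖ < δ := by simpa [dist_eq_norm] using hw
      have h2 : ‖deriv φ c * (w - c)‖ ≤ 2 * M := by
        rw [norm_mul]
        calc ‖deriv φ c‖ * ‖w - c‖ ≤ (2 * M / δ) * δ := by gcongr
          _ = 2 * M := by field_simp
      have h3 : ‖φ w - φ c‖ ≤ 2 * M := by simpa [dist_eq_norm] using hmaps hw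
      have : ψ w - ψ c = (φ w - φ c) - deriv φ c * (w - c) := by simp [hψ]; ring
      rw [mem_closedBall, dist_eq_norm, this]
      linarith [norm_sub_le (φ w - φ c) (deriv φ c * (w - c))]
    · have := hasDerivAt_iff_isLittleO.1 hdφ
      simp only [pow_one]
      refine (this.norm_right).congr_left fun w => ?_
      simp [hψ]; ring
  have e : (φ (c + h) - φ c) / h - deriv φ c = (ψ (c + h) - ψ c) / h := by
    simp only [hψ]; field_simp; ring
  rw [e, norm_div, ← dist_eq_norm, div_le_iff₀ (norm_pos_iff.2 h0)]
  refine key.trans (le_of_eq ?_)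
  simp only [dist_eq_norm, add_sub_cancel_left, div_pow]
  field_simp
  ring

/-- By the Schwarz lemma `f` is Lipschitz in the first variable, uniformly in the second; continuity
in the second variable alone then suffices. -/
theorem SepHol.continuousOn {f : ℂ × ℂ → ℂ} (hf : SepHol f) : ContinuousOn f bidisc := by
  rintro ⟨a, b⟩ ⟨ha, hb⟩
  apply ContinuousAt.continuousWithinAt
  simp only [mem_ball_zero_iff] at ha hb
  obtain ⟨R, hR, hR1⟩ := exists_between (max_lt ha hb)
  have hRa := (le_max_left _ _).trans_lt hR
  have hRb := (le_max_right _ _).trans_lt hR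
  obtain ⟨M, hM⟩ := hf.bdd R hR1
  have hδ : 0 < R - ‖a‖ := by linarith
  have hsub : ∀ w ∈ ball a (R - ‖a‖), ‖w‖ < R := fun w hw => by
    rw [mem_ball, dist_eq_norm] at hw
    linarith [norm_sub_norm_le w a]
  have h2 : Tendsto (fun z : ℂ × ℂ => f (a, z.2)) (𝓝 (a, b)) (𝓝 (f (a, b))) :=
    Tendsto.comp (g := fun w => f (a, w)) (((hf.right a (by simpa using ha)).continuousOn).continuousAt
      (isOpen_ball.mem_nhds (by simpa using hb))) (continuous_snd.tendsto (a, b))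
  have h1 : Tendsto (fun z : ℂ × ℂ => f z - f (a, z.2)) (𝓝 (a, b)) (𝓝 0) := by
    refine squeeze_zero_norm' (a := fun z : ℂ × ℂ => 2 * M / (R - ‖a‖) * dist z.1 a) ?_ ?_
    · have n1 : ∀ᶠ z : ℂ × ℂ in 𝓝 (a, b), z.1 ∈ ball a (R - ‖a‖) :=
        (continuous_fst.tendsto (a, b)).eventually (ball_mem_nhds a hδ)
      have n2 : ∀ᶠ z : ℂ × ℂ in 𝓝 (a, b), z.2 ∈ ball (0 : ℂ) R :=
        (continuous_snd.tendsto (a, b)).eventually (isOpen_ball.mem_nhds (by simpa using hRb))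
      filter_upwards [n1, n2] with z hz1 hz2
      have hz2' : ‖z.2‖ < R := by simpa using hz2
      rw [← dist_eq_norm]
      refine Complex.dist_le_div_mul_dist_of_mapsTo_ball (f := fun w => f (w, z.2)) (c := a)
        ((hf.left z.2 (by simpa using hz2'.trans hR1)).mono fun w hw => ?_) (fun w hw => ?_) hz1
      · simpa using (hsub w hw).trans hR1
      · rw [mem_closedBall, dist_eq_norm]
        linarith [norm_sub_le (f (w, z.2)) (f (a, z.2)), hM w z.2 (hsub w hw).le hz2'.le,
          hM a z.2 hRa.le hz2'.le]
    · have : Tendsto (fun z : ℂ × ℂ => 2 * M / (R - ‖a‖) * dist z.1 a) (𝓝 (a, b))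
          (𝓝 (2 * M / (R - ‖a‖) * dist a a)) :=
        Continuous.tendsto (f := fun z : ℂ × ℂ => 2 * M / (R - ‖a‖) * dist z.1 a)
          (by fun_prop) (a, b)
      simpa using this
  simpa [ContinuousAt] using h1.add h2

theorem SepHol.norm_partial₁_le {f : ℂ × ℂ → ℂ} (hf : SepHol f) {R S ε : ℝ} (hRS : R < S)
    (hS : S < 1) (hε : ∀ a b : ℂ, ‖a‖ ≤ S → ‖b‖ ≤ S → ‖f (a, b)‖ ≤ ε) {a b : ℂ} (ha : ‖a‖ ≤ R)
    (hb : ‖b‖ ≤ R) : ‖partial₁ f (a, b)‖ ≤ ε / (S - R) := by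
  have hsub : closedBall a (S - R) ⊆ closedBall 0 S := fun w hw => by
    rw [mem_closedBall, dist_eq_norm] at hw
    rw [mem_closedBall, dist_zero_right]
    linarith [norm_sub_norm_le w a]
  refine Complex.norm_deriv_le_of_forall_mem_sphere_norm_le (sub_pos.2 hRS) ?_ fun w hw => ?_
  · refine ((hf.left b ?_).mono ?_).diffContOnCl
    · simpa using hb.trans_lt (hRS.trans hS)
    · exact closure_ball_subset_closedBall.trans (hsub.trans (closedBall_subset_ball hS))
  · exact hε w b (by simpa using hsub (sphere_subset_closedBall hw)) (hb.trans hRS.le)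

/-- The derivative is a locally uniform limit of difference quotients, each holomorphic in the
second variable. Local bounds come from Cauchy's estimate. -/
theorem SepHol.partial₁ {f : ℂ × ℂ → ℂ} (hf : SepHol f) : SepHol (partial₁ f) where
  left b hb := (hf.left b hb).deriv isOpen_ball
  right a ha := by
    have ha' : ‖a‖ < 1 := by simpa using ha
    have aux : ∀ R : ℝ, R < 1 →
        DifferentiableOn ℂ (fun w => BidiscDirichlet.partial₁ f (a, w)) (ball 0 R) := by
      intro R hR
      obtain ⟨S, hS, hS1⟩ := exists_between (max_lt ha' hR)
      have hSa := (le_max_left _ _).trans_lt hS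
      have hSR := (le_max_right _ _).trans_lt hS
      obtain ⟨M, hM⟩ := hf.bdd S hS1
      have hδ : 0 < S - ‖a‖ := by linarith
      have hsub : ∀ w ∈ ball a (S - ‖a‖), ‖w‖ < S := fun w hw => by
        rw [mem_ball, dist_eq_norm] at hw
        linarith [norm_sub_norm_le w a]
      have hsm : ∀ᶠ h : ℂ in 𝓝[≠] 0, h ≠ 0 ∧ ‖h‖ < S - ‖a‖ := by
        refine eventually_nhdsWithin_iff.2 ?_
        filter_upwards [ball_mem_nhds (0 : ℂ) hδ] with h hh h0
        exact ⟨h0, by simpa using hh⟩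
      have hlim : Tendsto (fun h : ℂ => 4 * M / (S - ‖a‖) ^ 2 * ‖h‖) (𝓝[≠] 0) (𝓝 0) := by
        have : Tendsto (fun h : ℂ => 4 * M / (S - ‖a‖) ^ 2 * ‖h‖) (𝓝 0)
            (𝓝 (4 * M / (S - ‖a‖) ^ 2 * ‖(0 : ℂ)‖)) :=
          Continuous.tendsto (by fun_prop) 0
        rw [norm_zero, mul_zero] at this
        exact this.mono_left nhdsWithin_le_nhds
      refine TendstoLocallyUniformlyOn.differentiableOn (φ := 𝓝[≠] (0 : ℂ))
        (F := fun h w => (f (a + h, w) - f (a, w)) / h) ?_ ?_ isOpen_ball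
      · refine TendstoUniformlyOn.tendstoLocallyUniformlyOn ?_
        rw [Metric.tendstoUniformlyOn_iff]
        intro ε hε
        filter_upwards [hsm, hlim.eventually (gt_mem_nhds hε)] with h ⟨h0, hh⟩ hlt w hw
        have hw' : ‖w‖ < R := by simpa using hw
        rw [dist_comm, dist_eq_norm]
        refine (norm_slope_sub_deriv_le (φ := fun z => f (z, w)) (M := M)
          ((hf.left w (by simpa using hw'.trans hR)).mono fun z hz => ?_) (fun z hz => ?_)
          h0 hh).trans_lt hlt
        · simpa using (hsub z hz).trans hS1
        · exact hM _ _ (hsub z hz).le (hw'.trans hSR).le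
      · filter_upwards [hsm] with h ⟨h0, hh⟩
        have hah : a + h ∈ ball (0 : ℂ) 1 := by
          simpa using (hsub (a + h) (by simpa using hh)).trans hS1
        exact (((hf.right _ hah).sub (hf.right a ha)).div_const h).mono
          (ball_subset_ball hR.le)
    intro w hw
    obtain ⟨R, hR, hR1⟩ := exists_between (mem_ball_zero_iff.1 hw)
    exact ((aux R hR1).differentiableAt
      (isOpen_ball.mem_nhds (by simpa using hR))).differentiableWithinAt
  bdd R hR := by
    obtain ⟨S, hS, hS1⟩ := exists_between hR
    obtain ⟨M, hM⟩ := hf.bdd S hS1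
    exact ⟨M / (S - R), fun a b ha hb => hf.norm_partial₁_le hS hS1 hM ha hb⟩

theorem SepHol.partial₂ {f : ℂ × ℂ → ℂ} (hf : SepHol f) : SepHol (partial₂ f) :=
  hf.swap.partial₁.swap

theorem SepHol.norm_partial₂_le {f : ℂ × ℂ → ℂ} (hf : SepHol f) {R S ε : ℝ} (hRS : R < S)
    (hS : S < 1) (hε : ∀ a b : ℂ, ‖a‖ ≤ S → ‖b‖ ≤ S → ‖f (a, b)‖ ≤ ε) {a b : ℂ} (ha : ‖a‖ ≤ R)
    (hb : ‖b‖ ≤ R) : ‖BidiscDirichlet.partial₂ f (a, b)‖ ≤ ε / (S - R) :=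
  hf.swap.norm_partial₁_le hRS hS (fun a b ha hb => hε b a hb ha) hb ha

theorem partial₁_sub {f g : ℂ × ℂ → ℂ} (hf : SepHol f) (hg : SepHol g) {z : ℂ × ℂ}
    (hz : z ∈ bidisc) : partial₁ (f - g) z = partial₁ f z - partial₁ g z :=
  deriv_sub ((hf.left _ hz.2).differentiableAt (isOpen_ball.mem_nhds hz.1))
    ((hg.left _ hz.2).differentiableAt (isOpen_ball.mem_nhds hz.1))

theorem partial₂_sub {f g : ℂ × ℂ → ℂ} (hf : SepHol f) (hg : SepHol g) {z : ℂ × ℂ}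
    (hz : z ∈ bidisc) : partial₂ (f - g) z = partial₂ f z - partial₂ g z :=
  deriv_sub ((hf.right _ hz.1).differentiableAt (isOpen_ball.mem_nhds hz.2))
    ((hg.right _ hz.1).differentiableAt (isOpen_ball.mem_nhds hz.2))

theorem partial₁_dilate (r : ℝ) (f : ℂ × ℂ → ℂ) (z : ℂ × ℂ) :
    partial₁ (dilate r f) z = r * dilate r (partial₁ f) z := by
  simpa [partial₁, dilate] using deriv_comp_mul_left (r : ℂ) (fun w => f (w, r * z.2)) z.1

theorem partial₂_dilate (r : ℝ) (f : ℂ × ℂ → ℂ) (z : ℂ × ℂ) :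
    partial₂ (dilate r f) z = r * dilate r (partial₂ f) z := by
  simpa [partial₂, dilate] using deriv_comp_mul_left (r : ℂ) (fun w => f (r * z.1, w)) z.2

/-! ### Polynomial approximation of dilates -/

theorem differentiable_polyFun (p : MvPolynomial (Fin 2) ℂ) : Differentiable ℂ (polyFun p) := by
  unfold polyFun
  induction p using MvPolynomial.induction_on with
  | C a => simp
  | add p q hp hq => simp only [map_add]; exact hp.add hq
  | mul_X p i hp =>
    simp only [map_mul, MvPolynomial.eval_X]
    refine hp.mul ?_
    fin_cases i
    · exact differentiable_fst
    · exact differentiable_snd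

theorem sepHol_polyFun (p : MvPolynomial (Fin 2) ℂ) : SepHol (polyFun p) :=
  sepHol_of_differentiableOn (differentiable_polyFun p).differentiableOn

/-- No restriction on `r`: the value `2` serves later to write a polynomial as a dilate. -/
theorem exists_polyFun_eq_dilate (r : ℝ) (p : MvPolynomial (Fin 2) ℂ) :
    ∃ q, polyFun q = dilate r (polyFun p) := by
  refine ⟨MvPolynomial.bind₁ (fun i => MvPolynomial.C (r : ℂ) * MvPolynomial.X i) p, ?_⟩
  ext z
  simp only [polyFun, dilate]
  induction p using MvPolynomial.induction_on with
  | C a => simp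
  | add p q hp hq => simp only [map_add, hp, hq]
  | mul_X p i hp =>
    simp only [map_mul, hp, MvPolynomial.bind₁_X_right, MvPolynomial.eval_C, MvPolynomial.eval_X]
    fin_cases i <;> rfl

/-- Cauchy's estimates on the circle of radius `S` dominate the Taylor series by a geometric one of
ratio `R / S`. -/
theorem norm_taylor_tail_le {φ : ℂ → ℂ} {R S M : ℝ} (hφ : DifferentiableOn ℂ φ (ball 0 1))
    (hR : 0 ≤ R) (hRS : R < S) (hS : S < 1) (hM : ∀ w, ‖w‖ ≤ S → ‖φ w‖ ≤ M) (N : ℕ) {z : ℂ}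
    (hz : ‖z‖ ≤ R) :
    ‖φ z - ∑ n ∈ Finset.range N, ((n.factorial : ℂ)⁻¹ * iteratedDeriv n φ 0) * z ^ n‖ ≤
      M * (R / S) ^ N / (1 - R / S) := by
  have hS0 : 0 < S := hR.trans_lt hRS
  have hM0 : 0 ≤ M := (norm_nonneg _).trans (hM 0 (by simpa using hS0.le))
  have hsum := Complex.hasSum_taylorSeries_on_ball (c := 0) hφ
    (show z ∈ ball (0 : ℂ) 1 by simpa using hz.trans_lt (hRS.trans hS))
  rw [norm_sub_rev]
  have hd : DiffContOnCl ℂ φ (ball 0 S) :=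
    (hφ.mono (closure_ball_subset_closedBall.trans (closedBall_subset_ball hS))).diffContOnCl
  refine norm_sub_le_of_geometric_bound_of_hasSum ((div_lt_one hS0).2 hRS) (fun n => ?_)
    (hsum.congr_fun ?_) N
  · have h1 := Complex.norm_iteratedDeriv_le_of_forall_mem_sphere_norm_le n hS0 hd
      (C := M) fun w hw => hM w (by simp at hw; exact hw.le)
    have hn : (0 : ℝ) < n.factorial := by exact_mod_cast n.factorial_pos
    rw [norm_mul, norm_mul, norm_pow, norm_inv, Complex.norm_natCast]
    calc (n.factorial : ℝ)⁻¹ * ‖iteratedDeriv n φ 0‖ * ‖z‖ ^ n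
        ≤ (n.factorial : ℝ)⁻¹ * (n.factorial * M / S ^ n) * R ^ n := by gcongr
      _ = M * (R / S) ^ n := by rw [div_pow]; field_simp
  · intro n
    simp [smul_eq_mul]; ring

theorem exists_partial_taylor {φ : ℂ → ℂ} {R ε : ℝ} (hφ : DifferentiableOn ℂ φ (ball 0 1))
    (hR : 0 ≤ R) (hR1 : R < 1) (hε : 0 < ε) :
    ∃ (N : ℕ) (c : ℕ → ℂ), ∀ z, ‖z‖ ≤ R → ‖φ z - ∑ n ∈ Finset.range N, c n * z ^ n‖ ≤ ε := by
  obtain ⟨S, hS, hS1⟩ := exists_between hR1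
  have hS0 : 0 < S := hR.trans_lt hS
  obtain ⟨M, hM⟩ := (isCompact_closedBall (0 : ℂ) S).exists_bound_of_continuousOn
    (hφ.continuousOn.mono (closedBall_subset_ball hS1))
  have hlim : Tendsto (fun N : ℕ => M * (R / S) ^ N / (1 - R / S)) atTop (𝓝 0) := by
    simpa using ((tendsto_pow_atTop_nhds_zero_of_lt_one (by positivity)
      ((div_lt_one hS0).2 hS)).const_mul M).div_const (1 - R / S)
  obtain ⟨N, hN⟩ := (hlim.eventually (gt_mem_nhds hε)).exists
  exact ⟨N, _, fun z hz => (norm_taylor_tail_le hφ hR hS hS1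
    (fun w hw => hM w (by simpa using hw)) N hz).trans hN.le⟩

theorem iterate_partial₁ (f : ℂ × ℂ → ℂ) (n : ℕ) (a b : ℂ) :
    partial₁^[n] f (a, b) = iteratedDeriv n (fun w => f (w, b)) a := by
  induction n generalizing a with
  | zero => simp
  | succ n ih =>
    rw [Function.iterate_succ_apply', iteratedDeriv_succ, partial₁]
    simp only [ih]

theorem SepHol.iterate_partial₁ {f : ℂ × ℂ → ℂ} (hf : SepHol f) (n : ℕ) :
    SepHol (BidiscDirichlet.partial₁^[n] f) := by
  induction n with
  | zero => exact hf
  | succ n ih => rw [Function.iterate_succ_apply']; exact ih.partial₁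

/-- Truncate the Taylor series in the first variable; its coefficients are holomorphic in the second
variable, so truncate their Taylor series as well. -/
theorem SepHol.exists_polyFun_near {f : ℂ × ℂ → ℂ} (hf : SepHol f) {R ε : ℝ} (hR : 0 ≤ R)
    (hR1 : R < 1) (hε : 0 < ε) :
    ∃ p, ∀ a b : ℂ, ‖a‖ ≤ R → ‖b‖ ≤ R → ‖f (a, b) - polyFun p (a, b)‖ ≤ ε := by
  obtain ⟨S, hS, hS1⟩ := exists_between hR1
  have hS0 : 0 < S := hR.trans_lt hS
  obtain ⟨M, hM⟩ := hf.bdd S hS1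
  have hlim : Tendsto (fun N : ℕ => M * (R / S) ^ N / (1 - R / S)) atTop (𝓝 0) := by
    simpa using ((tendsto_pow_atTop_nhds_zero_of_lt_one (by positivity)
      ((div_lt_one hS0).2 hS)).const_mul M).div_const (1 - R / S)
  obtain ⟨N, hN⟩ := (hlim.eventually (gt_mem_nhds (half_pos hε))).exists
  set A : ℕ → ℂ → ℂ := fun n b =>
    (n.factorial : ℂ)⁻¹ * iteratedDeriv n (fun w => f (w, b)) 0 with hA
  have hAd : ∀ n, DifferentiableOn ℂ (A n) (ball 0 1) := fun n => by
    have := ((hf.iterate_partial₁ n).right 0 (by simp)).const_mul (n.factorial : ℂ)⁻¹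
    simpa only [BidiscDirichlet.iterate_partial₁] using this
  -- There are `N` coefficients to replace; `N + 1` keeps the denominator nonzero.
  have hη : 0 < ε / (2 * (N + 1)) := by positivity
  choose K c hc using fun n => exists_partial_taylor (hAd n) hR hR1 hη
  refine ⟨∑ n ∈ Finset.range N, (∑ k ∈ Finset.range (K n),
    MvPolynomial.C (c n k) * MvPolynomial.X 1 ^ k) * MvPolynomial.X 0 ^ n, fun a b ha hb => ?_⟩
  have hp : polyFun (∑ n ∈ Finset.range N, (∑ k ∈ Finset.range (K n),
      MvPolynomial.C (c n k) * MvPolynomial.X 1 ^ k) * MvPolynomial.X 0 ^ n) (a, b) =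
      ∑ n ∈ Finset.range N, (∑ k ∈ Finset.range (K n), c n k * b ^ k) * a ^ n := by
    simp [polyFun]
  rw [hp]
  have h1 : ‖f (a, b) - ∑ n ∈ Finset.range N, A n b * a ^ n‖ ≤ ε / 2 :=
    (norm_taylor_tail_le (hf.left b (by simpa using hb.trans_lt hR1)) hR hS hS1
      (fun w hw => hM w b hw (hb.trans hS.le)) N ha).trans hN.le
  have h2 : ‖∑ n ∈ Finset.range N, A n b * a ^ n -
      ∑ n ∈ Finset.range N, (∑ k ∈ Finset.range (K n), c n k * b ^ k) * a ^ n‖ ≤ ε / 2 := by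
    rw [← Finset.sum_sub_distrib]
    refine (norm_sum_le_of_le _ (f := fun n => A n b * a ^ n -
      (∑ k ∈ Finset.range (K n), c n k * b ^ k) * a ^ n)
      (fun n _ => show _ ≤ ε / (2 * (N + 1)) from ?_)).trans ?_
    · rw [← sub_mul, norm_mul, norm_pow]
      have : ‖a‖ ^ n ≤ 1 := pow_le_one₀ (norm_nonneg a) (ha.trans hR1.le)
      calc _ ≤ ε / (2 * (N + 1)) * 1 := by gcongr; exact hc n b hb
        _ = _ := mul_one _
    · rw [Finset.sum_const, Finset.card_range, nsmul_eq_mul]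
      have : (0 : ℝ) ≤ N := N.cast_nonneg
      rw [mul_div_assoc', div_le_div_iff₀ (by positivity) (by positivity)]
      nlinarith
  have := norm_sub_le_norm_sub_add_norm_sub (f (a, b)) (∑ n ∈ Finset.range N, A n b * a ^ n)
    (∑ n ∈ Finset.range N, (∑ k ∈ Finset.range (K n), c n k * b ^ k) * a ^ n)
  linarith

theorem SepHol.exists_polyFun_near_deriv {f : ℂ × ℂ → ℂ} (hf : SepHol f) {R ε : ℝ} (hR : 0 ≤ R)
    (hR1 : R < 1) (hε : 0 < ε) :
    ∃ p, ∀ a b : ℂ, ‖a‖ ≤ R → ‖b‖ ≤ R → ‖(f - polyFun p) (a, b)‖ ≤ ε ∧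
      ‖BidiscDirichlet.partial₁ (f - polyFun p) (a, b)‖ ≤ ε ∧
      ‖BidiscDirichlet.partial₂ (f - polyFun p) (a, b)‖ ≤ ε := by
  obtain ⟨S, hS, hS1⟩ := exists_between hR1
  have hd : 0 < S - R := sub_pos.2 hS
  -- Cauchy's estimate divides by `S - R`, which the tolerance compensates; `S - R ≤ 1` covers the
  -- function itself.
  obtain ⟨p, hp⟩ := hf.exists_polyFun_near (hR.trans hS.le) hS1 (mul_pos hε hd)
  have h := hf.sub (sepHol_polyFun p)
  refine ⟨p, fun a b ha hb => ⟨?_, ?_, ?_⟩⟩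
  · refine (hp a b (ha.trans hS.le) (hb.trans hS.le)).trans ?_
    nlinarith
  · simpa [hd.ne'] using h.norm_partial₁_le hS hS1 hp ha hb
  · simpa [hd.ne'] using h.norm_partial₂_le hS hS1 hp ha hb

/-- A dilate of a separately holomorphic function is close to a polynomial, together with its
first derivatives, on the whole bidisc. -/
theorem SepHol.exists_polyFun_near_dilate {f : ℂ × ℂ → ℂ} (hf : SepHol f) {r ε : ℝ} (hr : 0 ≤ r)
    (hr1 : r < 1) (hε : 0 < ε) :
    ∃ p, ∀ z ∈ bidisc, ‖(BidiscDirichlet.dilate r f - polyFun p) z‖ ≤ ε ∧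
      ‖BidiscDirichlet.partial₁ (BidiscDirichlet.dilate r f - polyFun p) z‖ ≤ ε ∧
      ‖BidiscDirichlet.partial₂ (BidiscDirichlet.dilate r f - polyFun p) z‖ ≤ ε := by
  obtain ⟨p, hp⟩ := hf.exists_polyFun_near_deriv hr hr1 hε
  obtain ⟨q, hq⟩ := exists_polyFun_eq_dilate r p
  refine ⟨q, fun z hz => ?_⟩
  have e : BidiscDirichlet.dilate r f - polyFun q =
      BidiscDirichlet.dilate r (f - polyFun p) := by
    rw [hq]; rfl
  have aux : ∀ w ∈ ball (0 : ℂ) 1, ‖(r : ℂ) * w‖ ≤ r := fun w hw => by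
    rw [mem_ball_zero_iff] at hw
    rw [norm_mul, Complex.norm_of_nonneg hr]
    exact mul_le_of_le_one_right hr hw.le
  obtain ⟨h1, h2, h3⟩ := hp (r * z.1) (r * z.2) (aux _ hz.1) (aux _ hz.2)
  rw [e, partial₁_dilate, partial₂_dilate, norm_mul, norm_mul, Complex.norm_of_nonneg hr]
  exact ⟨h1, (mul_le_of_le_one_left (norm_nonneg _) hr1.le).trans h2,
    (mul_le_of_le_one_left (norm_nonneg _) hr1.le).trans h3⟩

/-! ### The Poisson kernel on concentric circles -/

instance : IsProbabilityMeasure arcMeasure where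
  measure_univ := by
    have : ENNReal.ofReal (2 * Real.pi) ≠ 0 := by simpa using Real.pi_pos
    rw [arcMeasure, Measure.smul_apply, Measure.restrict_apply_univ, Real.volume_Icc, sub_zero,
      smul_eq_mul, ENNReal.inv_mul_cancel this ENNReal.ofReal_ne_top]

theorem integral_arcMeasure {E : Type*} [NormedAddCommGroup E] [NormedSpace ℝ E] (F : ℂ → E)
    (R : ℝ) : ∫ θ, F (circleMap 0 R θ) ∂arcMeasure = Real.circleAverage F 0 R := by
  rw [arcMeasure, integral_smul_measure, Real.circleAverage_def,
    intervalIntegral.integral_of_le Real.two_pi_pos.le, integral_Icc_eq_integral_Ioc]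
  rw [ENNReal.toReal_inv, ENNReal.toReal_ofReal Real.two_pi_pos.le]

theorem integrable_arcMeasure {E : Type*} [NormedAddCommGroup E] {F : ℝ → E}
    (hF : Continuous F) : Integrable F arcMeasure :=
  (hF.integrableOn_Icc (a := 0) (b := 2 * Real.pi)).smul_measure (by simpa using Real.pi_pos)

/-- The Poisson kernel of the circle, as a symmetric function of two angles. -/
def circleKernel (q θ s : ℝ) : ℝ≥0∞ :=
  ENNReal.ofReal ((1 - q ^ 2) / ‖circleMap 0 1 θ - circleMap 0 q s‖ ^ 2)

/-- Both squared distances equal `1 - 2 q cos (θ - s) + q ^ 2`. This symmetry lets one kernel serve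
first for the function and then for the weight. -/
theorem circleKernel_comm (q θ s : ℝ) : circleKernel q θ s = circleKernel q s θ := by
  have h : ‖circleMap 0 1 θ - circleMap 0 q s‖ ^ 2 = ‖circleMap 0 1 s - circleMap 0 q θ‖ ^ 2 := by
    rw [← Complex.normSq_eq_norm_sq, ← Complex.normSq_eq_norm_sq]
    simp only [circleMap, zero_add, Complex.ofReal_one, one_mul, Complex.normSq_apply,
      Complex.sub_re, Complex.sub_im, Complex.exp_ofReal_mul_I_re, Complex.exp_ofReal_mul_I_im,
      Complex.re_ofReal_mul, Complex.im_ofReal_mul]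
    linear_combination (1 - q ^ 2) * (Real.sin_sq_add_cos_sq θ - Real.sin_sq_add_cos_sq s)
  rw [circleKernel, circleKernel, h]

theorem circleKernel_zero (θ s : ℝ) : circleKernel 0 θ s = 1 := by simp [circleKernel]

theorem measurable_circleKernel (q : ℝ) :
    Measurable fun p : ℝ × ℝ => circleKernel q p.1 p.2 := by
  unfold circleKernel circleMap
  fun_prop

/-- Scale invariance: only the ratio of the two radii matters. -/
theorem poissonKernel_circleMap {q t : ℝ} (ht : 0 < t) (θ s : ℝ) :
    _root_.poissonKernel 0 (circleMap 0 (q * t) s) (circleMap 0 t θ) =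
      (1 - q ^ 2) / ‖circleMap 0 1 θ - circleMap 0 q s‖ ^ 2 := by
  have e : circleMap 0 t θ - circleMap 0 (q * t) s =
      (t : ℂ) * (circleMap 0 1 θ - circleMap 0 q s) := by
    simp [circleMap]; ring
  rw [poissonKernel_def]
  simp only [sub_zero]
  rw [e, norm_mul, norm_circleMap_zero, norm_circleMap_zero, Complex.norm_real, Real.norm_eq_abs,
    mul_pow, sq_abs, sq_abs, show t ^ 2 - (q * t) ^ 2 = t ^ 2 * (1 - q ^ 2) by ring]
  exact mul_div_mul_left _ _ (by positivity)

theorem circleMap_mem_ball_of_lt {q t : ℝ} (hq : 0 ≤ q) (hq1 : q < 1) (ht : 0 < t) (s : ℝ) :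
    circleMap 0 (q * t) s ∈ ball (0 : ℂ) t := by
  rw [mem_ball_zero_iff, norm_circleMap_zero, abs_of_nonneg (by positivity)]
  nlinarith

theorem circleMap_mem_ball {t : ℝ} (ht : 0 ≤ t) (ht1 : t < 1) (s : ℝ) :
    circleMap 0 t s ∈ ball (0 : ℂ) 1 := by
  rwa [mem_ball_zero_iff, norm_circleMap_zero, abs_of_nonneg ht]

theorem continuous_comp_circleMap {E : Type*} [TopologicalSpace E] {g : ℂ → E}
    (hg : ContinuousOn g (ball 0 1)) {t : ℝ} (ht : 0 ≤ t) (ht1 : t < 1) :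
    Continuous fun θ => g (circleMap 0 t θ) :=
  hg.comp_continuous (continuous_circleMap 0 t) fun θ => circleMap_mem_ball ht ht1 θ

/-- The Poisson inequality for the subharmonic function `|g|²`. -/
theorem enorm_sq_le_lintegral_circleKernel {g : ℂ → ℂ} (hg : DifferentiableOn ℂ g (ball 0 1))
    {q t : ℝ} (hq : 0 ≤ q) (hq1 : q < 1) (ht : 0 < t) (ht1 : t < 1) (s : ℝ) :
    ‖g (circleMap 0 (q * t) s)‖ₑ ^ 2 ≤
      ∫⁻ θ, circleKernel q θ s * ‖g (circleMap 0 t θ)‖ₑ ^ 2 ∂arcMeasure := by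
  -- The Poisson formula for the holomorphic function `g ^ 2`, followed by the triangle inequality,
  -- replaces any appeal to subharmonicity.
  have hd : DiffContOnCl ℂ (fun z => g z ^ 2) (ball 0 t) :=
    ((hg.pow 2).mono (closure_ball_subset_closedBall.trans
      (closedBall_subset_ball ht1))).diffContOnCl
  have h := hd.circleAverage_poissonKernel_smul (circleMap_mem_ball_of_lt hq hq1 ht s)
  rw [← integral_arcMeasure] at h
  rw [← enorm_pow, ← h]
  refine (enorm_integral_le_lintegral_enorm _).trans (le_of_eq (lintegral_congr fun θ => ?_))
  rw [Pi.smul_apply', poissonKernel_circleMap ht, enorm_smul, enorm_pow, circleKernel,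
    Real.enorm_of_nonneg]
  have : 0 ≤ 1 - q ^ 2 := by nlinarith
  positivity

theorem lintegral_circleKernel_mul_harmonic {h : ℂ → ℝ} {q ρ : ℝ} (hq : 0 ≤ q) (hq1 : q < 1)
    (hρ : 0 < ρ) (hh : HarmonicOnNhd h (closedBall 0 ρ)) (h0 : ∀ w ∈ sphere (0 : ℂ) ρ, 0 ≤ h w)
    (s : ℝ) :
    ∫⁻ θ, circleKernel q θ s * ENNReal.ofReal (h (circleMap 0 ρ θ)) ∂arcMeasure =
      ENNReal.ofReal (h (circleMap 0 (q * ρ) s)) := by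
  have hP : ∀ θ, 0 ≤ (1 - q ^ 2) / ‖circleMap 0 1 θ - circleMap 0 q s‖ ^ 2 := fun θ => by
    have : 0 ≤ 1 - q ^ 2 := by nlinarith
    positivity
  have hne : ∀ θ, ‖circleMap 0 1 θ - circleMap 0 q s‖ ^ 2 ≠ 0 := fun θ => by
    have := norm_sub_norm_le (circleMap 0 1 θ) (circleMap 0 q s)
    rw [norm_circleMap_zero, norm_circleMap_zero, abs_one, abs_of_nonneg hq] at this
    have : 0 < ‖circleMap 0 1 θ - circleMap 0 q s‖ := by linarith
    positivity
  have hc : Continuous fun θ => h (circleMap 0 ρ θ) :=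
    (HarmonicOnNhd.continuousOn hh).comp_continuous (continuous_circleMap 0 ρ) fun θ =>
      sphere_subset_closedBall (circleMap_mem_sphere 0 hρ.le θ)
  have key := hh.circleAverage_poissonKernel_smul (circleMap_mem_ball_of_lt hq hq1 hρ s)
  rw [← integral_arcMeasure] at key
  rw [← key, ofReal_integral_eq_lintegral_ofReal]
  · refine lintegral_congr fun θ => ?_
    rw [Pi.smul_apply', poissonKernel_circleMap hρ, smul_eq_mul, ENNReal.ofReal_mul (hP θ),
      circleKernel]
  · refine integrable_arcMeasure ?_
    simp only [Pi.smul_apply', poissonKernel_circleMap hρ, smul_eq_mul]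
    refine Continuous.mul (Continuous.div continuous_const ?_ hne) hc
    fun_prop
  · refine ae_of_all _ fun θ => ?_
    simp only [Pi.zero_apply]
    rw [Pi.smul_apply', poissonKernel_circleMap hρ, smul_eq_mul]
    exact mul_nonneg (hP θ) (h0 _ (circleMap_mem_sphere 0 hρ.le θ))

/-! ### Harmonic minorants of the Green and Poisson kernels -/

/-- For all but at most one radius `ρ < 1`, the function `k` agrees on the circle of radius `ρ`
with a harmonic function that is at most `k` inside the circle and at most `2 / ρ` at its centre.
-/
def HasHarmonicMinorants (k : ℂ → ℝ≥0∞) : Prop :=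
  ∃ ρ₀ : ℝ, ∀ ρ ∈ Ioo (0 : ℝ) 1, ρ ≠ ρ₀ → ∃ h : ℂ → ℝ, HarmonicOnNhd h (closedBall 0 ρ) ∧
    (∀ w ∈ sphere (0 : ℂ) ρ, 0 ≤ h w ∧ k w = ENNReal.ofReal (h w)) ∧
    (∀ w ∈ ball (0 : ℂ) ρ, ENNReal.ofReal (h w) ≤ k w) ∧ h 0 ≤ 2 / ρ

/-- With `ρ = 1` this makes the Green kernel nonnegative. For `‖ζ‖ < ρ` it compares `w - ζ` with its
zero-free substitute on the disc of radius `ρ`, with equality of moduli (up to the factor `ρ`) on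
the boundary. -/
theorem norm_sq_sub_conj_mul (ρ : ℝ) (ζ w : ℂ) :
    ‖(ρ : ℂ) ^ 2 - (starRingEnd ℂ) ζ * w‖ ^ 2 =
      ρ ^ 2 * ‖w - ζ‖ ^ 2 + (ρ ^ 2 - ‖ζ‖ ^ 2) * (ρ ^ 2 - ‖w‖ ^ 2) := by
  simp only [← Complex.normSq_eq_norm_sq]
  simp only [Complex.normSq_apply, Complex.sub_re, Complex.sub_im, Complex.mul_re, Complex.mul_im,
    Complex.conj_re, Complex.conj_im, pow_two, Complex.ofReal_re, Complex.ofReal_im]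
  ring

/-- Use `log y ≤ y - 1`; the factor `1 - x` then cancels against `1 - x ^ 2`. -/
theorem two_mul_log_inv_div_le {x : ℝ} (h0 : 0 < x) (h1 : x < 1) :
    2 * Real.log x⁻¹ / (1 - x ^ 2) ≤ 2 / x := by
  have h2 : 0 < 1 - x ^ 2 := by nlinarith
  have h3 := Real.log_le_sub_one_of_pos (inv_pos.2 h0)
  rw [div_le_div_iff₀ h2 h0]
  have h4 : Real.log x⁻¹ * x ≤ (x⁻¹ - 1) * x := mul_le_mul_of_nonneg_right h3 h0.le
  rw [sub_mul, inv_mul_cancel₀ h0.ne'] at h4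
  nlinarith

theorem one_sub_conj_mul_ne_zero {ζ w : ℂ} (hζ : ‖ζ‖ < 1) (hw : ‖w‖ < 1) :
    1 - (starRingEnd ℂ) ζ * w ≠ 0 := by
  intro h
  have : ‖(starRingEnd ℂ) ζ * w‖ = 1 := by rw [← sub_eq_zero.1 h, norm_one]
  rw [norm_mul, RCLike.norm_conj] at this
  nlinarith [norm_nonneg ζ, norm_nonneg w]

theorem greenKernel_of_ne {ζ w : ℂ} (h : w ≠ ζ) :
    greenKernel ζ w = ENNReal.ofReal
      (2 / (1 - ‖ζ‖ ^ 2) * Real.log ‖(1 - (starRingEnd ℂ) ζ * w) / (w - ζ)‖) := by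
  rw [greenKernel, if_neg h, Real.log_pow]
  congr 1
  push_cast
  ring

theorem harmonicOnNhd_const_mul_log_norm {f : ℂ → ℂ} {s : Set ℂ} (c : ℝ)
    (hf : ∀ w ∈ s, AnalyticAt ℂ f w) (h0 : ∀ w ∈ s, f w ≠ 0) :
    HarmonicOnNhd (fun w => c * Real.log ‖f w‖) s := fun w hw =>
  ((hf w hw).harmonicAt_log_norm (h0 w hw)).const_smul (c := c)

/-- For `ρ < ‖ζ‖` the kernel itself is harmonic near the closed disc. For `ρ > ‖ζ‖` replace `w - ζ`
by `(ρ² - conj ζ * w) / ρ`, which has no zero there, the same modulus on the circle and a larger one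
inside; this removes the logarithmic pole. Only `ρ = ‖ζ‖`, where the pole lies on the circle, is
excluded. -/
theorem greenKernel_hasHarmonicMinorants {ζ : ℂ} (hζ : ‖ζ‖ < 1) :
    HasHarmonicMinorants (greenKernel ζ) := by
  have hz2 : 0 < 1 - ‖ζ‖ ^ 2 := by nlinarith [norm_nonneg ζ]
  refine ⟨‖ζ‖, fun ρ ⟨hρ, hρ1⟩ hne => ?_⟩
  have hnum : ∀ w ∈ closedBall (0 : ℂ) ρ, 1 - (starRingEnd ℂ) ζ * w ≠ 0 := fun w hw =>
    one_sub_conj_mul_ne_zero hζ ((mem_closedBall_zero_iff.1 hw).trans_lt hρ1)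
  have hge : ∀ w ∈ closedBall (0 : ℂ) ρ, ‖w - ζ‖ ≤ ‖1 - (starRingEnd ℂ) ζ * w‖ := fun w hw => by
    have h1 := norm_sq_sub_conj_mul 1 ζ w
    have h2 : ‖w‖ ≤ ρ := mem_closedBall_zero_iff.1 hw
    simp only [Complex.ofReal_one, one_pow, one_mul] at h1
    refine le_of_sq_le_sq ?_ (norm_nonneg _)
    have : 0 ≤ (1 - ‖ζ‖ ^ 2) * (1 - ‖w‖ ^ 2) :=
      mul_nonneg hz2.le (by nlinarith [norm_nonneg w])
    linarith
  rcases lt_or_gt_of_ne hne with hlt | hgt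
  · have hwz : ∀ w ∈ closedBall (0 : ℂ) ρ, w ≠ ζ := fun w hw h => by
      rw [mem_closedBall_zero_iff, h] at hw
      linarith
    have hgr : ∀ w ∈ closedBall (0 : ℂ) ρ, greenKernel ζ w = _ := fun w hw =>
      greenKernel_of_ne (hwz w hw)
    refine ⟨_, harmonicOnNhd_const_mul_log_norm (2 / (1 - ‖ζ‖ ^ 2))
      (f := fun w => (1 - (starRingEnd ℂ) ζ * w) / (w - ζ)) (fun w hw => ?_) (fun w hw => ?_),
      fun w hw => ⟨?_, hgr w (sphere_subset_closedBall hw)⟩,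
      fun w hw => (hgr w (ball_subset_closedBall hw)).ge, ?_⟩
    · exact AnalyticAt.div (by fun_prop) (by fun_prop) (sub_ne_zero.2 (hwz w hw))
    · exact div_ne_zero (hnum w hw) (sub_ne_zero.2 (hwz w hw))
    · have hw' := sphere_subset_closedBall hw
      refine mul_nonneg (by positivity) (Real.log_nonneg ?_)
      rw [norm_div, one_le_div (norm_pos_iff.2 (sub_ne_zero.2 (hwz w hw')))]
      exact hge w hw'
    · have h0 : 0 < ‖ζ‖ := hρ.trans hlt
      have := two_mul_log_inv_div_le h0 hζ
      have e : ‖(1 - (starRingEnd ℂ) ζ * 0) / (0 - ζ)‖ = ‖ζ‖⁻¹ := by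
        rw [mul_zero, sub_zero, zero_sub, norm_div, norm_neg, norm_one, one_div]
      calc _ = 2 * Real.log ‖ζ‖⁻¹ / (1 - ‖ζ‖ ^ 2) := by rw [e]; ring
        _ ≤ _ := this
        _ ≤ 2 / ρ := by gcongr
  · have hden : ∀ w ∈ closedBall (0 : ℂ) ρ, (ρ : ℂ) ^ 2 - (starRingEnd ℂ) ζ * w ≠ 0 := by
      intro w hw h
      have h1 := congrArg norm (sub_eq_zero.1 h)
      have h2 : ‖w‖ ≤ ρ := mem_closedBall_zero_iff.1 hw
      rw [norm_mul, RCLike.norm_conj, norm_pow, Complex.norm_of_nonneg hρ.le] at h1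
      nlinarith [norm_nonneg ζ, norm_nonneg w]
    have hle : ∀ w ∈ closedBall (0 : ℂ) ρ,
        ρ * ‖w - ζ‖ ≤ ‖(ρ : ℂ) ^ 2 - (starRingEnd ℂ) ζ * w‖ := fun w hw => by
      have h1 := norm_sq_sub_conj_mul ρ ζ w
      have h2 : ‖w‖ ≤ ρ := mem_closedBall_zero_iff.1 hw
      refine le_of_sq_le_sq ?_ (norm_nonneg _)
      have : 0 ≤ (ρ ^ 2 - ‖ζ‖ ^ 2) * (ρ ^ 2 - ‖w‖ ^ 2) :=
        mul_nonneg (by nlinarith [norm_nonneg ζ]) (by nlinarith [norm_nonneg w])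
      rw [mul_pow]
      linarith
    have heq : ∀ w ∈ sphere (0 : ℂ) ρ,
        ‖(1 - (starRingEnd ℂ) ζ * w) * ρ / ((ρ : ℂ) ^ 2 - (starRingEnd ℂ) ζ * w)‖ =
          ‖(1 - (starRingEnd ℂ) ζ * w) / (w - ζ)‖ := fun w hw => by
      have h1 := norm_sq_sub_conj_mul ρ ζ w
      have h2 : ‖w‖ = ρ := mem_sphere_zero_iff_norm.1 hw
      rw [h2, sub_self, mul_zero, add_zero, ← mul_pow] at h1
      have h3 := (pow_left_inj₀ (norm_nonneg _) (by positivity) two_ne_zero).1 h1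
      rw [norm_div, norm_mul, h3, norm_div, Complex.norm_of_nonneg hρ.le, mul_comm,
        mul_div_mul_left _ _ hρ.ne']
    refine ⟨_, harmonicOnNhd_const_mul_log_norm (2 / (1 - ‖ζ‖ ^ 2))
      (f := fun w => (1 - (starRingEnd ℂ) ζ * w) * ρ / ((ρ : ℂ) ^ 2 - (starRingEnd ℂ) ζ * w))
      (fun w hw => ?_) (fun w hw => ?_), fun w hw => ?_, fun w hw => ?_, ?_⟩
    · exact AnalyticAt.div (by fun_prop) (by fun_prop) (hden w hw)
    · exact div_ne_zero (mul_ne_zero (hnum w hw) (by exact_mod_cast hρ.ne')) (hden w hw)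
    · have hwz : w ≠ ζ := fun h => by
        rw [mem_sphere_zero_iff_norm, h] at hw
        exact hgt.ne hw
      simp only [heq w hw]
      refine ⟨mul_nonneg (by positivity) (Real.log_nonneg ?_), greenKernel_of_ne hwz⟩
      rw [norm_div, one_le_div (norm_pos_iff.2 (sub_ne_zero.2 hwz))]
      exact hge w (sphere_subset_closedBall hw)
    · have hw' := ball_subset_closedBall hw
      by_cases hwz : w = ζ
      · rw [greenKernel, if_pos hwz]
        exact le_top
      rw [greenKernel_of_ne hwz]
      refine ENNReal.ofReal_le_ofReal (mul_le_mul_of_nonneg_left (Real.log_le_log ?_ ?_)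
        (by positivity))
      · exact norm_pos_iff.2 (div_ne_zero
          (mul_ne_zero (hnum w hw') (by exact_mod_cast hρ.ne')) (hden w hw'))
      · rw [norm_div, norm_div, norm_mul, Complex.norm_of_nonneg hρ.le,
          div_le_div_iff₀ (norm_pos_iff.2 (hden w hw')) (norm_pos_iff.2 (sub_ne_zero.2 hwz)),
          mul_assoc]
        exact mul_le_mul_of_nonneg_left (hle w hw') (norm_nonneg _)
    · have := two_mul_log_inv_div_le hρ hρ1
      have e : ‖(1 - (starRingEnd ℂ) ζ * 0) * ρ / ((ρ : ℂ) ^ 2 - (starRingEnd ℂ) ζ * 0)‖ = ρ⁻¹ := by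
        rw [mul_zero, sub_zero, sub_zero, one_mul, norm_div, norm_pow,
          Complex.norm_of_nonneg hρ.le]
        field_simp
      have hlog : 0 ≤ Real.log ρ⁻¹ := Real.log_nonneg ((one_le_inv₀ hρ).2 hρ1.le)
      have hρ2 : 0 < 1 - ρ ^ 2 := by nlinarith
      calc _ = 2 * Real.log ρ⁻¹ / (1 - ‖ζ‖ ^ 2) := by rw [e]; ring
        _ ≤ 2 * Real.log ρ⁻¹ / (1 - ρ ^ 2) := by gcongr
        _ ≤ _ := this

/-- The kernel is the real part of `(ζ + w) / (ζ - w)`, hence its own minorant, with value `1` at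
the centre. No radius needs excluding, so `ρ₀ = 0` is a dummy. -/
theorem poissonKernel_hasHarmonicMinorants {ζ : ℂ} (hζ : ‖ζ‖ = 1) :
    HasHarmonicMinorants (poissonKernel ζ) := by
  refine ⟨0, fun ρ ⟨hρ, hρ1⟩ _ => ?_⟩
  have hk : ∀ w, poissonKernel ζ w = ENNReal.ofReal ((ζ + w) / (ζ - w)).re := fun w => by
    have := congrFun (poissonKernel_eq_re_herglotzRieszKernel (c := 0) (w := w)) ζ
    simp only [poissonKernel_def, Function.comp_apply, herglotzRieszKernel_def, sub_zero, hζ,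
      one_pow] at this
    rw [← this, poissonKernel]
  refine ⟨fun w => ((ζ + w) / (ζ - w)).re, fun w hw => ?_, fun w hw => ⟨?_, hk w⟩,
    fun w _ => (hk w).ge, ?_⟩
  · refine AnalyticAt.harmonicAt_re (f := fun w => (ζ + w) / (ζ - w))
      (AnalyticAt.div (by fun_prop) (by fun_prop) (sub_ne_zero.2 fun h => ?_))
    rw [mem_closedBall_zero_iff, ← h, hζ] at hw
    linarith
  · have := congrFun (poissonKernel_eq_re_herglotzRieszKernel (c := 0) (w := w)) ζ
    simp only [poissonKernel_def, Function.comp_apply, herglotzRieszKernel_def, sub_zero, hζ,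
      one_pow] at this
    simp only [← this]
    rw [mem_sphere_zero_iff_norm] at hw
    have : 0 ≤ 1 - ‖w‖ ^ 2 := by rw [hw]; nlinarith
    positivity
  · have : ζ ≠ 0 := fun h => by simp [h] at hζ
    simp only [add_zero, sub_zero, div_self this, Complex.one_re]
    rw [le_div_iff₀ hρ]
    linarith

/-! ### Comparison of circle means -/

/-- For a kernel with harmonic minorants, the weighted circle means of `|g|²` are compared at two
radii, the weight being moved inwards and the function outwards. -/
theorem lintegral_circle_dilate_le {g : ℂ → ℂ} (hg : DifferentiableOn ℂ g (ball 0 1))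
    {k : ℂ → ℝ≥0∞} (hkm : Measurable k) {h : ℂ → ℝ} {q ρ : ℝ} (hq : 0 < q) (hq1 : q < 1)
    (hρ : 0 < ρ) (hρ1 : ρ < 1) (hh : HarmonicOnNhd h (closedBall 0 ρ))
    (hk : ∀ w ∈ sphere (0 : ℂ) ρ, 0 ≤ h w ∧ k w = ENNReal.ofReal (h w))
    (hk' : ∀ w ∈ ball (0 : ℂ) ρ, ENNReal.ofReal (h w) ≤ k w) :
    ∫⁻ θ, ‖g (circleMap 0 (q * (q * ρ)) θ)‖ₑ ^ 2 * k (circleMap 0 ρ θ) ∂arcMeasure ≤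
      ∫⁻ s, ‖g (circleMap 0 (q * ρ) s)‖ₑ ^ 2 * k (circleMap 0 (q * ρ) s) ∂arcMeasure := by
  have ht : 0 < q * ρ := mul_pos hq hρ
  have ht1 : q * ρ < 1 := by nlinarith
  have hgm : Measurable fun s => ‖g (circleMap 0 (q * ρ) s)‖ₑ ^ 2 :=
    ((continuous_comp_circleMap hg.continuousOn ht.le ht1).measurable).enorm.pow_const 2
  have hkc : Measurable fun θ => k (circleMap 0 ρ θ) :=
    hkm.comp (continuous_circleMap 0 ρ).measurable
  calc
    _ ≤ ∫⁻ θ, ∫⁻ s, circleKernel q s θ * ‖g (circleMap 0 (q * ρ) s)‖ₑ ^ 2 *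
          k (circleMap 0 ρ θ) ∂arcMeasure ∂arcMeasure := by
      refine lintegral_mono fun θ => ?_
      rw [lintegral_mul_const]
      · gcongr
        exact enorm_sq_le_lintegral_circleKernel hg hq.le hq1 ht ht1 θ
      · exact ((measurable_circleKernel q).comp (measurable_id.prodMk measurable_const)).mul hgm
    _ = ∫⁻ s, ∫⁻ θ, circleKernel q s θ * ‖g (circleMap 0 (q * ρ) s)‖ₑ ^ 2 *
          k (circleMap 0 ρ θ) ∂arcMeasure ∂arcMeasure := by
      refine lintegral_lintegral_swap (Measurable.aemeasurable ?_)
      exact (((measurable_circleKernel q).comp measurable_swap).mul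
        (hgm.comp measurable_snd)).mul (hkc.comp measurable_fst)
    -- For fixed `s`, the `θ`-integral is the Poisson integral of `h` over the circle of radius `ρ`,
    -- that is, the value of `h` at radius `q * ρ`.
    _ ≤ _ := by
      refine lintegral_mono fun s => ?_
      have e : ∀ θ, circleKernel q s θ * ‖g (circleMap 0 (q * ρ) s)‖ₑ ^ 2 *
          k (circleMap 0 ρ θ) = ‖g (circleMap 0 (q * ρ) s)‖ₑ ^ 2 *
          (circleKernel q θ s * ENNReal.ofReal (h (circleMap 0 ρ θ))) := fun θ => by
        rw [circleKernel_comm, (hk _ (circleMap_mem_sphere 0 hρ.le θ)).2]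
        ring
      simp only [e]
      rw [lintegral_const_mul' _ _ (by finiteness),
        lintegral_circleKernel_mul_harmonic hq.le hq1 hρ hh fun w hw => (hk w hw).1]
      gcongr
      exact hk' _ (circleMap_mem_ball_of_lt hq.le hq1 hρ s)

theorem lintegral_circle_eq {k : ℂ → ℝ≥0∞} {h : ℂ → ℝ} {ρ : ℝ} (hρ : 0 < ρ)
    (hh : HarmonicOnNhd h (closedBall 0 ρ))
    (hk : ∀ w ∈ sphere (0 : ℂ) ρ, 0 ≤ h w ∧ k w = ENNReal.ofReal (h w)) :
    ∫⁻ θ, k (circleMap 0 ρ θ) ∂arcMeasure = ENNReal.ofReal (h 0) := by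
  have := lintegral_circleKernel_mul_harmonic le_rfl one_pos hρ hh (fun w hw => (hk w hw).1) 0
  simp only [circleKernel_zero, one_mul, zero_mul, circleMap_zero_radius,
    Function.const_apply] at this
  rw [← this]
  exact lintegral_congr fun θ => (hk _ (circleMap_mem_sphere 0 hρ.le θ)).2

/-- Circle means of `|g|²` increase with the radius. -/
theorem lintegral_circle_mono {g : ℂ → ℂ} (hg : DifferentiableOn ℂ g (ball 0 1)) {R R' : ℝ}
    (hR : 0 < R) (hRR : R ≤ R') (hR' : R' < 1) :
    ∫⁻ θ, ‖g (circleMap 0 R θ)‖ₑ ^ 2 ∂arcMeasure ≤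
      ∫⁻ θ, ‖g (circleMap 0 R' θ)‖ₑ ^ 2 ∂arcMeasure := by
  rcases hRR.eq_or_lt with rfl | hlt
  · exact le_rfl
  have h0 : 0 < R' := hR.trans hlt
  have hq : 0 < R / R' := by positivity
  have hq1 : R / R' < 1 := (div_lt_one h0).2 hlt
  have e : R = R / R' * R' := by field_simp
  have hgm : Measurable fun s => ‖g (circleMap 0 R' s)‖ₑ ^ 2 :=
    ((continuous_comp_circleMap hg.continuousOn h0.le hR').measurable).enorm.pow_const 2
  -- By symmetry the kernel also has mass one in its other angle, so averaging the Poisson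
  -- inequality over `θ` leaves the mean at radius `R'`.
  have hK : ∀ s, ∫⁻ θ, circleKernel (R / R') s θ ∂arcMeasure = 1 := fun s => by
    have := lintegral_circleKernel_mul_harmonic (h := fun _ => 1) hq.le hq1 h0
      (fun w _ => harmonicAt_const 1) (fun _ _ => zero_le_one) s
    simpa [circleKernel_comm _ s] using this
  calc
    _ ≤ ∫⁻ θ, ∫⁻ s, circleKernel (R / R') s θ * ‖g (circleMap 0 R' s)‖ₑ ^ 2
          ∂arcMeasure ∂arcMeasure := by
      refine lintegral_mono fun θ => ?_
      have := enorm_sq_le_lintegral_circleKernel hg hq.le hq1 h0 hR' θ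
      rwa [← e] at this
    _ = ∫⁻ s, ∫⁻ θ, circleKernel (R / R') s θ * ‖g (circleMap 0 R' s)‖ₑ ^ 2
          ∂arcMeasure ∂arcMeasure := by
      refine lintegral_lintegral_swap (Measurable.aemeasurable ?_)
      exact ((measurable_circleKernel _).comp measurable_swap).mul (hgm.comp measurable_snd)
    _ = _ := by
      refine lintegral_congr fun s => ?_
      rw [lintegral_mul_const' _ _ (by finiteness), hK, one_mul]

/-! ### Polar coordinates and weighted area integrals -/

theorem setLIntegral_Ioo_eq_of_periodic {G : ℝ → ℝ≥0∞} (hG : Function.Periodic G (2 * Real.pi)) :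
    ∫⁻ θ in Ioo (-Real.pi) Real.pi, G θ = ∫⁻ θ in Icc 0 (2 * Real.pi), G θ := by
  rw [setLIntegral_congr Ioo_ae_eq_Ioc, setLIntegral_congr (Ioc_ae_eq_Icc (a := 0)).symm]
  have h1 := isAddFundamentalDomain_Ioc Real.two_pi_pos (-Real.pi)
  have h2 := isAddFundamentalDomain_Ioc Real.two_pi_pos 0
  have := h1.setLIntegral_eq h2 G hG.map_vadd_zmultiples
  rwa [show -Real.pi + 2 * Real.pi = Real.pi by ring, zero_add] at this

/-- Integration over the unit disc in polar coordinates. -/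
theorem lintegral_areaMeasure {F : ℂ → ℝ≥0∞} (hF : Measurable ((ball (0 : ℂ) 1).indicator F)) :
    ∫⁻ w, F w ∂areaMeasure = ∫⁻ ρ in Ioo (0 : ℝ) 1,
      ENNReal.ofReal (2 * ρ) * ∫⁻ θ, F (circleMap 0 ρ θ) ∂arcMeasure := by
  have hπ : ENNReal.ofReal Real.pi ≠ 0 := by simpa using Real.pi_pos
  have hsymm : ∀ p : ℝ × ℝ, Complex.polarCoord.symm p = circleMap 0 p.1 p.2 := fun p => by
    simp [Complex.polarCoord_symm_apply, circleMap, Complex.exp_mul_I]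
  have hm : Measurable fun p : ℝ × ℝ => ENNReal.ofReal p.1 *
      (ball (0 : ℂ) 1).indicator F (circleMap 0 p.1 p.2) := by
    refine (measurable_fst.ennreal_ofReal).mul (hF.comp ?_)
    unfold circleMap
    fun_prop
  rw [areaMeasure, lintegral_smul_measure, ← lintegral_indicator measurableSet_ball,
    ← Complex.lintegral_comp_polarCoord_symm, polarCoord_target, Measure.volume_eq_prod,
    ← Measure.prod_restrict]
  simp only [hsymm, smul_eq_mul]
  rw [lintegral_prod _ hm.aemeasurable, ← Ioo_union_Ici_eq_Ioi (zero_lt_one (α := ℝ)),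
    lintegral_union measurableSet_Ici (Set.disjoint_left.2 fun x hx hx' => hx.2.not_ge hx')]
  have h0 : ∫⁻ ρ in Ici (1 : ℝ), ∫⁻ θ in Ioo (-Real.pi) Real.pi, ENNReal.ofReal ρ *
      (ball (0 : ℂ) 1).indicator F (circleMap 0 ρ θ) = 0 := by
    rw [setLIntegral_congr_fun (g := fun _ => 0) measurableSet_Ici fun ρ hρ => ?_]
    · simp
    · have : ∀ θ, circleMap 0 ρ θ ∉ ball (0 : ℂ) 1 := fun θ => by
        rw [mem_ball_zero_iff, norm_circleMap_zero, not_lt]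
        exact hρ.trans (le_abs_self ρ)
      simp [indicator_of_notMem (this _)]
  rw [h0, add_zero, ← lintegral_const_mul _ (by exact hm.lintegral_prod_right')]
  refine setLIntegral_congr_fun measurableSet_Ioo fun ρ hρ => ?_
  have hin : ∀ θ, (ball (0 : ℂ) 1).indicator F (circleMap 0 ρ θ) = F (circleMap 0 ρ θ) :=
    fun θ => indicator_of_mem (circleMap_mem_ball hρ.1.le hρ.2 θ) F
  simp only [hin]
  rw [lintegral_const_mul' _ _ ENNReal.ofReal_ne_top,
    setLIntegral_Ioo_eq_of_periodic fun θ => by rw [periodic_circleMap 0 ρ θ], arcMeasure,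
    lintegral_smul_measure, smul_eq_mul, ENNReal.ofReal_mul zero_le_two,
    ENNReal.ofReal_mul zero_le_two, ENNReal.ofReal_ofNat,
    ENNReal.mul_inv (Or.inl two_ne_zero) (Or.inl ENNReal.ofNat_ne_top)]
  -- The normalizations combine to `ρ / π = 2 ρ / (2 π)`.
  rw [show ∀ a b c d e : ℝ≥0∞, a * b * (c * d * e) = (a * c) * (d * (b * e)) by
    intros; ring, ENNReal.mul_inv_cancel two_ne_zero ENNReal.ofNat_ne_top, one_mul]

theorem measurable_indicator_ball {g : ℂ → ℂ} (hg : ContinuousOn g (ball 0 1)) :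
    Measurable ((ball (0 : ℂ) 1).indicator g) := by
  classical
  rw [← piecewise_eq_indicator]
  exact hg.measurable_piecewise continuousOn_const measurableSet_ball

theorem measurable_indicator_enorm_sq_mul {g : ℂ → ℂ} (hg : ContinuousOn g (ball 0 1))
    {k : ℂ → ℝ≥0∞} (hk : Measurable k) :
    Measurable ((ball (0 : ℂ) 1).indicator fun w => ‖g w‖ₑ ^ 2 * k w) := by
  have : ((ball (0 : ℂ) 1).indicator fun w => ‖g w‖ₑ ^ 2 * k w) =
      fun w => ‖(ball (0 : ℂ) 1).indicator g w‖ₑ ^ 2 * k w := by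
    ext w
    by_cases hw : w ∈ ball (0 : ℂ) 1
    · simp [indicator_of_mem hw]
    · simp [indicator_of_notMem hw]
  rw [this]
  exact ((measurable_indicator_ball hg).enorm.pow_const 2).mul hk

theorem ofReal_enorm_mul_sq {r : ℝ} (hr : 0 ≤ r) (z : ℂ) :
    ‖(r : ℂ) * z‖ₑ ^ 2 = ENNReal.ofReal (r ^ 2) * ‖z‖ₑ ^ 2 := by
  rw [enorm_mul, mul_pow, ENNReal.ofReal_pow hr, ← Real.enorm_of_nonneg hr]
  congr 2
  simp [enorm_eq_nnnorm]

theorem differentiableOn_comp_mul {g : ℂ → ℂ} (hg : DifferentiableOn ℂ g (ball 0 1)) {r : ℝ}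
    (h0 : 0 ≤ r) (h1 : r ≤ 1) : DifferentiableOn ℂ (fun w => (r : ℂ) * g (r * w)) (ball 0 1) := by
  refine DifferentiableOn.const_mul (hg.comp (f := fun w : ℂ => (r : ℂ) * w) (by fun_prop)
    fun w hw => ?_) _
  simpa using norm_ofReal_mul_lt_one h0 h1 (mem_ball_zero_iff.1 hw)

theorem HasHarmonicMinorants.lintegral_dilate_le {k : ℂ → ℝ≥0∞} (hk : HasHarmonicMinorants k)
    (hkm : Measurable k) {g : ℂ → ℂ} (hg : DifferentiableOn ℂ g (ball 0 1)) {r : ℝ} (hr : 0 < r)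
    (hr1 : r < 1) :
    ∫⁻ w, ‖(r : ℂ) * g (r * w)‖ₑ ^ 2 * k w ∂areaMeasure ≤ ∫⁻ w, ‖g w‖ₑ ^ 2 * k w ∂areaMeasure := by
  obtain ⟨ρ₀, hρ₀⟩ := hk
  -- The square root splits the dilation evenly: function and weight meet at radius `q * ρ`.
  set q := √r with hqdef
  have hq : 0 < q := Real.sqrt_pos.2 hr
  have hqq : q * q = r := Real.mul_self_sqrt hr.le
  have hq1 : q < 1 := by nlinarith
  rw [lintegral_areaMeasure (measurable_indicator_enorm_sq_mul
    (differentiableOn_comp_mul hg hr.le hr1.le).continuousOn hkm),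
    lintegral_areaMeasure (measurable_indicator_enorm_sq_mul hg.continuousOn hkm)]
  set Φ : ℝ → ℝ≥0∞ := fun σ => ENNReal.ofReal (2 * σ) *
    ∫⁻ θ, ‖g (circleMap 0 σ θ)‖ₑ ^ 2 * k (circleMap 0 σ θ) ∂arcMeasure with hΦ
  have himg : (fun ρ => q * ρ) '' Ioo (0 : ℝ) 1 ⊆ Ioo 0 1 := by
    rintro _ ⟨ρ, ⟨h0, h1⟩, rfl⟩
    exact ⟨mul_pos hq h0, by nlinarith⟩
  have hscale : ∫⁻ ρ in Ioo (0 : ℝ) 1, ENNReal.ofReal q * Φ (q * ρ) ≤ ∫⁻ σ in Ioo 0 1, Φ σ := by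
    have := lintegral_image_eq_lintegral_abs_deriv_mul (s := Ioo (0 : ℝ) 1) (f := fun ρ => q * ρ)
      (f' := fun _ => q) measurableSet_Ioo
      (fun x _ => by simpa using ((hasDerivAt_id x).const_mul q).hasDerivWithinAt)
      (fun x _ y _ h => mul_left_cancel₀ hq.ne' h) Φ
    rw [abs_of_pos hq] at this
    rw [← this]
    exact lintegral_mono_set himg
  refine le_trans ?_ hscale
  refine lintegral_mono_ae ?_
  have hne : ∀ᵐ ρ ∂(volume.restrict (Ioo (0 : ℝ) 1)), ρ ≠ ρ₀ :=
    ae_restrict_of_ae (Measure.ae_ne volume ρ₀)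
  filter_upwards [hne, ae_restrict_mem measurableSet_Ioo] with ρ hρne hρ
  obtain ⟨h, hh, hks, hkb, -⟩ := hρ₀ ρ hρ hρne
  have key := lintegral_circle_dilate_le hg hkm hq hq1 hρ.1 hρ.2 hh hks hkb
  have e : ∀ θ, ‖(r : ℂ) * g (r * circleMap 0 ρ θ)‖ₑ ^ 2 * k (circleMap 0 ρ θ) =
      ENNReal.ofReal (r ^ 2) *
        (‖g (circleMap 0 (q * (q * ρ)) θ)‖ₑ ^ 2 * k (circleMap 0 ρ θ)) := fun θ => by
    have : (r : ℂ) * circleMap 0 ρ θ = circleMap 0 (q * (q * ρ)) θ := by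
      rw [← mul_assoc, hqq]; simp [circleMap]; ring
    rw [this, ofReal_enorm_mul_sq hr.le, mul_assoc]
  simp only [e]
  rw [lintegral_const_mul' _ _ ENNReal.ofReal_ne_top]
  simp only [hΦ]
  rw [← mul_assoc (ENNReal.ofReal (2 * ρ)), ← mul_assoc (ENNReal.ofReal q)]
  refine mul_le_mul' ?_ key
  -- What is left is `2 ρ r ^ 2 ≤ q * (2 q ρ) = 2 ρ r`: on the left the chain-rule factor `r ^ 2`,
  -- on the right the Jacobian of `σ = q ρ`.
  rw [← ENNReal.ofReal_mul (by linarith [hρ.1]), ← ENNReal.ofReal_mul hq.le]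
  refine ENNReal.ofReal_le_ofReal ?_
  have : q * (2 * (q * ρ)) = 2 * ρ * r := by rw [← hqq]; ring
  rw [this]
  have := hρ.1
  gcongr
  nlinarith

/-- The circle mean is `h 0 ≤ 2 / ρ`, integrated against `2 ρ dρ`. The bound is the same for all
kernels, so it survives integration over `μ`. -/
theorem HasHarmonicMinorants.lintegral_le {k : ℂ → ℝ≥0∞} (hk : HasHarmonicMinorants k)
    (hkm : Measurable k) : ∫⁻ w, k w ∂areaMeasure ≤ 4 := by
  obtain ⟨ρ₀, hρ₀⟩ := hk
  rw [lintegral_areaMeasure (hkm.indicator measurableSet_ball)]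
  have : ∫⁻ _ in Ioo (0 : ℝ) 1, (4 : ℝ≥0∞) = 4 := by simp
  rw [← this]
  refine lintegral_mono_ae ?_
  have hne : ∀ᵐ ρ ∂(volume.restrict (Ioo (0 : ℝ) 1)), ρ ≠ ρ₀ :=
    ae_restrict_of_ae (Measure.ae_ne volume ρ₀)
  filter_upwards [hne, ae_restrict_mem measurableSet_Ioo] with ρ hρne hρ
  obtain ⟨h, hh, hks, -, h0⟩ := hρ₀ ρ hρ hρne
  have hρ0 := hρ.1
  rw [lintegral_circle_eq hρ.1 hh hks, ← ENNReal.ofReal_mul (by positivity)]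
  calc _ ≤ ENNReal.ofReal (2 * ρ * (2 / ρ)) := by gcongr
    _ = 4 := by
      rw [show 2 * ρ * (2 / ρ) = 4 by field_simp; norm_num]; simp

/-! ### The weight as a potential -/

/-- The kernel of which `weight μ` is the potential. -/
def weightKernel (ζ : closedBall (0 : ℂ) 1) (w : ℂ) : ℝ≥0∞ :=
  if ‖(ζ : ℂ)‖ < 1 then greenKernel ζ w else poissonKernel ζ w

theorem weightKernel_hasHarmonicMinorants (ζ : closedBall (0 : ℂ) 1) :
    HasHarmonicMinorants (weightKernel ζ) := by
  unfold weightKernel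
  split_ifs with h
  · exact greenKernel_hasHarmonicMinorants h
  · exact poissonKernel_hasHarmonicMinorants
      (le_antisymm (mem_closedBall_zero_iff.1 ζ.2) (not_lt.1 h))

theorem measurable_weightKernel :
    Measurable fun p : closedBall (0 : ℂ) 1 × ℂ => weightKernel p.1 p.2 := by
  have hc : Measurable fun p : closedBall (0 : ℂ) 1 × ℂ => (p.1 : ℂ) :=
    measurable_subtype_coe.comp measurable_fst
  have hconj : Measurable fun p : closedBall (0 : ℂ) 1 × ℂ => (starRingEnd ℂ) (p.1 : ℂ) :=
    Complex.continuous_conj.measurable.comp hc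
  unfold weightKernel greenKernel poissonKernel
  refine Measurable.ite (measurableSet_lt hc.norm measurable_const)
    (Measurable.ite (measurableSet_eq_fun measurable_snd hc) measurable_const ?_) ?_
  · refine Measurable.ennreal_ofReal (Measurable.div (Real.measurable_log.comp
      (Measurable.pow_const (Measurable.norm (Measurable.div ?_ ?_)) 2)) ?_)
    · exact (hconj.mul measurable_snd).const_sub 1
    · exact measurable_snd.sub hc
    · exact (hc.norm.pow_const 2).const_sub 1
  · exact Measurable.ennreal_ofReal (Measurable.div ((measurable_snd.norm.pow_const 2).const_sub 1)
      ((hc.sub measurable_snd).norm.pow_const 2))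

section Weight

variable (μ : Measure (closedBall (0 : ℂ) 1))

theorem weight_eq_lintegral (w : ℂ) : weight μ w = ∫⁻ ζ, weightKernel ζ w ∂μ := by
  have hs : MeasurableSet {ζ : closedBall (0 : ℂ) 1 | ‖(ζ : ℂ)‖ < 1} :=
    measurableSet_lt measurable_subtype_coe.norm measurable_const
  have hs' : MeasurableSet {ζ : closedBall (0 : ℂ) 1 | ‖(ζ : ℂ)‖ = 1} :=
    measurableSet_eq_fun measurable_subtype_coe.norm measurable_const
  have hc : {ζ : closedBall (0 : ℂ) 1 | ‖(ζ : ℂ)‖ < 1}ᶜ =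
      {ζ : closedBall (0 : ℂ) 1 | ‖(ζ : ℂ)‖ = 1} := by
    ext ζ
    have := mem_closedBall_zero_iff.1 ζ.2
    simp only [mem_compl_iff, mem_ofPred_eq, not_lt]
    exact ⟨fun h => le_antisymm this h, fun h => h.ge⟩
  rw [← lintegral_add_compl _ hs, hc, weight]
  congr 1
  · exact setLIntegral_congr_fun hs fun ζ hζ => (if_pos hζ).symm
  · exact setLIntegral_congr_fun hs' fun ζ hζ => (if_neg (not_lt.2 (ge_of_eq hζ))).symm

theorem measurable_weight [SFinite μ] : Measurable (weight μ) := by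
  have := (measurable_weightKernel.comp measurable_swap).lintegral_prod_right' (ν := μ)
  rw [funext (weight_eq_lintegral μ)]
  exact this

instance : IsFiniteMeasure areaMeasure where
  measure_univ_lt_top := by
    have : (ENNReal.ofReal Real.pi)⁻¹ ≠ ⊤ := by simpa using Real.pi_pos
    rw [areaMeasure, Measure.smul_apply, Measure.restrict_apply_univ, smul_eq_mul]
    exact ENNReal.mul_lt_top this.lt_top measure_ball_lt_top

theorem lintegral_weight_lt_top [IsFiniteMeasure μ] : ∫⁻ w, weight μ w ∂areaMeasure < ⊤ := by
  simp only [weight_eq_lintegral]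
  rw [lintegral_lintegral_swap (f := fun w ζ => weightKernel ζ w)
    (measurable_weightKernel.comp measurable_swap).aemeasurable]
  calc _ ≤ ∫⁻ _, 4 ∂μ := lintegral_mono fun ζ =>
        (weightKernel_hasHarmonicMinorants ζ).lintegral_le
          (measurable_weightKernel.comp measurable_prodMk_left)
    _ < ⊤ := by
      rw [lintegral_const]
      exact ENNReal.mul_lt_top (by finiteness) (measure_lt_top μ univ)

/-- Tonelli reduces weighted estimates to one kernel at a time. -/
theorem lintegral_mul_weight [SFinite μ] {g : ℂ → ℂ} (hg : ContinuousOn g (ball 0 1)) :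
    ∫⁻ w, ‖g w‖ₑ ^ 2 * weight μ w ∂areaMeasure =
      ∫⁻ ζ, ∫⁻ w, ‖g w‖ₑ ^ 2 * weightKernel ζ w ∂areaMeasure ∂μ := by
  have hga : AEMeasurable g areaMeasure := (hg.aemeasurable measurableSet_ball).smul_measure _
  rw [← lintegral_lintegral_swap]
  · refine lintegral_congr fun w => ?_
    rw [weight_eq_lintegral, lintegral_const_mul' _ _ (by finiteness)]
  · exact ((hga.enorm.pow_const 2).comp_fst).mul
      (measurable_weightKernel.comp measurable_swap).aemeasurable

/-- Dilations contract the weighted Dirichlet integral. -/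
theorem lintegral_weight_dilate_le [SFinite μ] {g : ℂ → ℂ} (hg : DifferentiableOn ℂ g (ball 0 1))
    {r : ℝ} (hr : 0 < r) (hr1 : r < 1) :
    ∫⁻ w, ‖(r : ℂ) * g (r * w)‖ₑ ^ 2 * weight μ w ∂areaMeasure ≤
      ∫⁻ w, ‖g w‖ₑ ^ 2 * weight μ w ∂areaMeasure := by
  rw [lintegral_mul_weight μ (differentiableOn_comp_mul hg hr.le hr1.le).continuousOn,
    lintegral_mul_weight μ hg.continuousOn]
  exact lintegral_mono fun ζ => (weightKernel_hasHarmonicMinorants ζ).lintegral_dilate_le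
    (measurable_weightKernel.comp measurable_prodMk_left) hg hr hr1

end Weight

/-! ### Increasing quadratic means and convergence -/

/-- A family of measures on the bidisc along which the means of `|G|²`, for `G` separately
holomorphic, increase. -/
structure IsMeanFamily (m : ℝ → Measure (ℂ × ℂ)) : Prop where
  ae_mem : ∀ R ∈ Ioo (0 : ℝ) 1, ∀ᵐ z ∂m R, z ∈ bidisc
  mono : ∀ G, SepHol G → ∀ R R' : ℝ, 0 < R → R ≤ R' → R' < 1 →
    ∫⁻ z, ‖G z‖ₑ ^ 2 ∂m R ≤ ∫⁻ z, ‖G z‖ₑ ^ 2 ∂m R'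
  mass : ∃ C : ℝ≥0∞, C ≠ ⊤ ∧ ∀ R ∈ Ioo (0 : ℝ) 1, m R univ ≤ C

/-- The supremum of the means of `|G|²`. -/
def quad (m : ℝ → Measure (ℂ × ℂ)) (G : ℂ × ℂ → ℂ) : ℝ≥0∞ :=
  ⨆ R : Ioo (0 : ℝ) 1, ∫⁻ z, ‖G z‖ₑ ^ 2 ∂m R

theorem isOpen_bidisc : IsOpen bidisc := isOpen_ball.prod isOpen_ball

theorem measurableSet_bidisc : MeasurableSet bidisc := isOpen_bidisc.measurableSet

theorem SepHol.aemeasurable {G : ℂ × ℂ → ℂ} (hG : SepHol G) {m : Measure (ℂ × ℂ)}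
    (hm : ∀ᵐ z ∂m, z ∈ bidisc) : AEMeasurable G m := by
  have := hG.continuousOn.aemeasurable (μ := m) measurableSet_bidisc
  rwa [Measure.restrict_eq_self_of_ae_mem hm] at this

theorem IsMeanFamily.quad_congr {m : ℝ → Measure (ℂ × ℂ)} (hm : IsMeanFamily m)
    {G H : ℂ × ℂ → ℂ} (h : EqOn G H bidisc) : quad m G = quad m H := by
  refine iSup_congr fun R => lintegral_congr_ae ?_
  filter_upwards [hm.ae_mem R R.2] with z hz
  rw [h hz]

theorem enorm_parallelogram (x y : ℂ) :
    ‖x + y‖ₑ ^ 2 + ‖x - y‖ₑ ^ 2 = 2 * ‖x‖ₑ ^ 2 + 2 * ‖y‖ₑ ^ 2 := by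
  have e : ∀ z : ℂ, ‖z‖ₑ ^ 2 = ENNReal.ofReal (‖z‖ ^ 2) := fun z => by
    rw [ENNReal.ofReal_pow (norm_nonneg z), ofReal_norm]
  have h2 : (2 : ℝ≥0∞) = ENNReal.ofReal 2 := by simp
  simp only [e, h2]
  rw [← ENNReal.ofReal_mul zero_le_two, ← ENNReal.ofReal_mul zero_le_two,
    ← ENNReal.ofReal_add (by positivity) (by positivity),
    ← ENNReal.ofReal_add (by positivity) (by positivity)]
  have := parallelogram_law_with_norm ℝ x y
  congr 1
  nlinarith

/-- Monotonicity in the radius makes the supremum of a sum the sum of the suprema, so the pointwise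
law passes to `quad`. -/
theorem IsMeanFamily.quad_parallelogram {m : ℝ → Measure (ℂ × ℂ)} (hm : IsMeanFamily m)
    {G H : ℂ × ℂ → ℂ} (hG : SepHol G) (hH : SepHol H) :
    quad m (G + H) + quad m (G - H) = 2 * quad m G + 2 * quad m H := by
  have mono : ∀ G, SepHol G → Monotone fun R : Ioo (0 : ℝ) 1 => ∫⁻ z, ‖G z‖ₑ ^ 2 ∂m R :=
    fun G hG R R' hR => hm.mono G hG R R' R.2.1 hR R'.2.2
  have mono2 : ∀ G, SepHol G →
      Monotone fun R : Ioo (0 : ℝ) 1 => 2 * ∫⁻ z, ‖G z‖ₑ ^ 2 ∂m R :=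
    fun G hG => (mono G hG).const_mul' 2
  unfold quad
  rw [ENNReal.mul_iSup, ENNReal.mul_iSup,
    ENNReal.iSup_add_iSup_of_monotone (mono _ (hG.add hH)) (mono _ (hG.sub hH)),
    ENNReal.iSup_add_iSup_of_monotone (mono2 _ hG) (mono2 _ hH)]
  refine iSup_congr fun R => ?_
  have hae := hm.ae_mem R R.2
  have h1 := ((hG.add hH).aemeasurable hae).enorm.pow_const 2
  have h2 := (hG.aemeasurable hae).enorm.pow_const 2
  rw [← lintegral_add_left' h1, ← lintegral_const_mul' _ _ (by simp),
    ← lintegral_const_mul' _ _ (by simp), ← lintegral_add_left' (h2.const_mul 2)]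
  exact lintegral_congr fun z => enorm_parallelogram (G z) (H z)

theorem IsMeanFamily.quad_add_le {m : ℝ → Measure (ℂ × ℂ)} (hm : IsMeanFamily m)
    {G H : ℂ × ℂ → ℂ} (hG : SepHol G) (hH : SepHol H) :
    quad m (G + H) ≤ 2 * quad m G + 2 * quad m H :=
  le_self_add.trans (hm.quad_parallelogram hG hH).le

theorem IsMeanFamily.exists_quad_le {m : ℝ → Measure (ℂ × ℂ)} (hm : IsMeanFamily m) :
    ∃ C : ℝ≥0∞, C ≠ ⊤ ∧ ∀ (G : ℂ × ℂ → ℂ) (ε : ℝ), (∀ z ∈ bidisc, ‖G z‖ ≤ ε) →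
      quad m G ≤ ENNReal.ofReal ε ^ 2 * C := by
  obtain ⟨C, hC, hmC⟩ := hm.mass
  refine ⟨C, hC, fun G ε hG => iSup_le fun R => ?_⟩
  calc _ ≤ ∫⁻ _, ENNReal.ofReal ε ^ 2 ∂m R := by
        refine lintegral_mono_ae ?_
        filter_upwards [hm.ae_mem R R.2] with z hz
        rw [← ofReal_norm]
        gcongr
        exact hG z hz
    _ = ENNReal.ofReal ε ^ 2 * m R univ := lintegral_const _
    _ ≤ _ := by gcongr; exact hmC R R.2

/-- Pointwise convergence without gain of mass implies convergence in the mean. -/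
theorem IsMeanFamily.eventually_quad_sub_le {m : ℝ → Measure (ℂ × ℂ)} (hm : IsMeanFamily m)
    {G : ℂ × ℂ → ℂ} {H : ℕ → ℂ × ℂ → ℂ} (hG : SepHol G) (hH : ∀ n, SepHol (H n))
    (hlim : ∀ z ∈ bidisc, Tendsto (fun n => H n z) atTop (𝓝 (G z)))
    (hle : ∀ n, quad m (H n) ≤ quad m G) (hfin : quad m G ≠ ⊤) {ε : ℝ≥0∞} (hε : ε ≠ 0) :
    ∀ᶠ n in atTop, quad m (G - H n) ≤ ε := by
  have hpar : ∀ n, quad m (G + H n) + quad m (G - H n) ≤ 4 * quad m G := fun n => by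
    rw [hm.quad_parallelogram hG (hH n)]
    calc _ ≤ 2 * quad m G + 2 * quad m G := by gcongr; exact hle n
      _ = _ := by ring
  have hfin4 : 4 * quad m G ≠ ⊤ := ENNReal.mul_ne_top (by simp) hfin
  -- The strict inequality `4 * quad m G - ε < 4 * quad m G` below needs a nonzero left term.
  rcases eq_or_ne (4 * quad m G) 0 with h0 | h0
  · refine Eventually.of_forall fun n => ?_
    have := le_add_self.trans (hpar n)
    rw [h0] at this
    exact this.trans zero_le
  have hlt : 4 * quad m G - ε < 4 * quad m G := ENNReal.sub_lt_self hfin4 h0 hε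
  have h4 : 4 * quad m G = ⨆ R : Ioo (0 : ℝ) 1, ∫⁻ z, ‖G z + G z‖ₑ ^ 2 ∂m R := by
    rw [quad, ENNReal.mul_iSup]
    refine iSup_congr fun R => ?_
    rw [← lintegral_const_mul' _ _ (by simp)]
    refine lintegral_congr fun z => ?_
    rw [← two_mul, enorm_mul, mul_pow]
    congr 1
    rw [← ofReal_norm, ← ENNReal.ofReal_pow (norm_nonneg _)]
    norm_num
  -- A single radius already captures `‖2G‖²` up to `ε`; Fatou is applied at that radius.
  obtain ⟨R, hR⟩ := lt_iSup_iff.1 (hlt.trans_eq h4)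
  have hae := hm.ae_mem R R.2
  have hfatou : ∫⁻ z, ‖G z + G z‖ₑ ^ 2 ∂m R ≤
      liminf (fun n => ∫⁻ z, ‖G z + H n z‖ₑ ^ 2 ∂m R) atTop := by
    refine le_trans (lintegral_mono_ae ?_) (lintegral_liminf_le' fun n =>
      ((hG.add (hH n)).aemeasurable hae).enorm.pow_const 2)
    filter_upwards [hae] with z hz
    have : Tendsto (fun n => ‖G z + H n z‖ₑ ^ 2) atTop (𝓝 (‖G z + G z‖ₑ ^ 2)) :=
      (((ENNReal.continuous_pow 2).comp continuous_enorm).tendsto _).comp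
        ((hlim z hz).const_add (G z))
    exact this.liminf_eq.ge
  filter_upwards [eventually_lt_of_lt_liminf (hR.trans_le hfatou)] with n hn
  have hn' : 4 * quad m G ≤ quad m (G + H n) + ε := by
    have h1 : 4 * quad m G - ε ≤ quad m (G + H n) :=
      hn.le.trans (le_iSup (fun R : Ioo (0 : ℝ) 1 => ∫⁻ z, ‖(G + H n) z‖ₑ ^ 2 ∂m R) R)
    exact tsub_le_iff_right.1 h1
  have hfin' : quad m (G + H n) ≠ ⊤ := ne_top_of_le_ne_top hfin4 (le_self_add.trans (hpar n))
  -- The term of `G + H n` takes up all but `ε` of the parallelogram bound, so at most `ε` is left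
  -- for `G - H n`.
  exact (ENNReal.add_le_add_iff_left hfin').1 ((hpar n).trans hn')

/-! ### The three mean families of the norm -/

/-- Normalized arc length on the circle of radius `R`, as a measure on `ℂ`. -/
def circleMeasure (R : ℝ) : Measure ℂ := arcMeasure.map (circleMap 0 R)

instance (R : ℝ) : IsProbabilityMeasure (circleMeasure R) :=
  Measure.isProbabilityMeasure_map (continuous_circleMap 0 R).aemeasurable

theorem lintegral_circleMeasure {F : ℂ → ℝ≥0∞} (hF : Measurable F) (R : ℝ) :
    ∫⁻ z, F z ∂circleMeasure R = ∫⁻ θ, F (circleMap 0 R θ) ∂arcMeasure :=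
  lintegral_map hF (continuous_circleMap 0 R).measurable

theorem ae_circleMeasure_mem_ball {R : ℝ} (hR : R ∈ Ioo (0 : ℝ) 1) :
    ∀ᵐ z ∂circleMeasure R, z ∈ ball (0 : ℂ) 1 :=
  (ae_map_iff (continuous_circleMap 0 R).aemeasurable measurableSet_ball).2
    (ae_of_all _ fun θ => circleMap_mem_ball hR.1.le hR.2 θ)

theorem ae_prod_mem_bidisc {ν ν' : Measure ℂ} [SFinite ν] [SFinite ν']
    (h : ∀ᵐ z ∂ν, z ∈ ball (0 : ℂ) 1) (h' : ∀ᵐ z ∂ν', z ∈ ball (0 : ℂ) 1) :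
    ∀ᵐ z ∂ν.prod ν', z ∈ bidisc := by
  filter_upwards [Measure.quasiMeasurePreserving_fst.ae h,
    Measure.quasiMeasurePreserving_snd.ae h'] with z h1 h2 using ⟨h1, h2⟩

theorem lintegral_prod_mono_right {ν : Measure ℂ} [SFinite ν] (h : ∀ᵐ z ∂ν, z ∈ ball (0 : ℂ) 1)
    {G : ℂ × ℂ → ℂ} (hG : SepHol G) {R R' : ℝ} (hR : 0 < R) (hRR : R ≤ R') (hR' : R' < 1) :
    ∫⁻ z, ‖G z‖ₑ ^ 2 ∂ν.prod (circleMeasure R) ≤ ∫⁻ z, ‖G z‖ₑ ^ 2 ∂ν.prod (circleMeasure R') := by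
  have key : ∀ S ∈ Ioo (0 : ℝ) 1, ∫⁻ z, ‖G z‖ₑ ^ 2 ∂ν.prod (circleMeasure S) =
      ∫⁻ a, ∫⁻ θ, ‖G (a, circleMap 0 S θ)‖ₑ ^ 2 ∂arcMeasure ∂ν := fun S hS => by
    rw [lintegral_prod _ ((hG.aemeasurable
      (ae_prod_mem_bidisc h (ae_circleMeasure_mem_ball hS))).enorm.pow_const 2)]
    refine lintegral_congr_ae ?_
    filter_upwards [h] with a ha
    have hm := ((measurable_indicator_ball (hG.right a ha).continuousOn).enorm.pow_const 2)
    have e := lintegral_circleMeasure hm S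
    rw [lintegral_congr_ae (g := fun b => ‖G (a, b)‖ₑ ^ 2) ?_] at e
    · rw [e]
      refine lintegral_congr fun θ => ?_
      rw [indicator_of_mem (circleMap_mem_ball hS.1.le hS.2 θ)]
    · filter_upwards [ae_circleMeasure_mem_ball hS] with b hb
      rw [indicator_of_mem hb]
  rw [key R ⟨hR, hRR.trans_lt hR'⟩, key R' ⟨hR.trans_le hRR, hR'⟩]
  refine lintegral_mono_ae ?_
  filter_upwards [h] with a ha
  exact lintegral_circle_mono (hG.right a ha) hR hRR hR'

theorem lintegral_prod_comm {ν ν' : Measure ℂ} [SFinite ν] [SFinite ν'] (F : ℂ × ℂ → ℝ≥0∞) :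
    ∫⁻ z, F z ∂ν.prod ν' = ∫⁻ z, F z.swap ∂ν'.prod ν := by
  rw [← Measure.prod_swap]
  exact lintegral_map_equiv F MeasurableEquiv.prodComm

theorem lintegral_prod_mono_left {ν : Measure ℂ} [SFinite ν] (h : ∀ᵐ z ∂ν, z ∈ ball (0 : ℂ) 1)
    {G : ℂ × ℂ → ℂ} (hG : SepHol G) {R R' : ℝ} (hR : 0 < R) (hRR : R ≤ R') (hR' : R' < 1) :
    ∫⁻ z, ‖G z‖ₑ ^ 2 ∂(circleMeasure R).prod ν ≤ ∫⁻ z, ‖G z‖ₑ ^ 2 ∂(circleMeasure R').prod ν := by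
  rw [lintegral_prod_comm, lintegral_prod_comm (ν := circleMeasure R')]
  exact lintegral_prod_mono_right h hG.swap hR hRR hR'

theorem isMeanFamily_circle :
    IsMeanFamily fun R => (circleMeasure R).prod (circleMeasure R) where
  ae_mem R hR := ae_prod_mem_bidisc (ae_circleMeasure_mem_ball hR) (ae_circleMeasure_mem_ball hR)
  -- The two radii are raised one after the other.
  mono G hG R R' hR hRR hR' :=
    (lintegral_prod_mono_right (ae_circleMeasure_mem_ball ⟨hR, hRR.trans_lt hR'⟩) hG hR hRR
      hR').trans (lintegral_prod_mono_left (ae_circleMeasure_mem_ball ⟨hR.trans_le hRR, hR'⟩) hG hR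
      hRR hR')
  mass := ⟨1, by simp, fun R _ => by simp⟩

/-- The measure `U_μ dA`. -/
def weightMeasure (μ : Measure (closedBall (0 : ℂ) 1)) : Measure ℂ :=
  areaMeasure.withDensity (weight μ)

theorem ae_areaMeasure_mem_ball : ∀ᵐ z ∂areaMeasure, z ∈ ball (0 : ℂ) 1 :=
  Measure.ae_smul_measure (ae_restrict_mem measurableSet_ball) _

theorem ae_weightMeasure_mem_ball (μ : Measure (closedBall (0 : ℂ) 1)) :
    ∀ᵐ z ∂weightMeasure μ, z ∈ ball (0 : ℂ) 1 :=
  (withDensity_absolutelyContinuous areaMeasure (weight μ)).ae_le ae_areaMeasure_mem_ball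

variable (μ : Measure (closedBall (0 : ℂ) 1)) [IsFiniteMeasure μ]

instance : IsFiniteMeasure (weightMeasure μ) :=
  isFiniteMeasure_withDensity (lintegral_weight_lt_top μ).ne

/-- The family of measures that computes the first term of the Dirichlet integral. -/
def leftFamily (μ : Measure (closedBall (0 : ℂ) 1)) (R : ℝ) : Measure (ℂ × ℂ) :=
  (weightMeasure μ).prod (circleMeasure R)

/-- The family of measures that computes the second term of the Dirichlet integral. -/
def rightFamily (μ : Measure (closedBall (0 : ℂ) 1)) (R : ℝ) : Measure (ℂ × ℂ) :=
  (circleMeasure R).prod (weightMeasure μ)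

theorem isMeanFamily_leftFamily : IsMeanFamily (leftFamily μ) where
  ae_mem R hR := ae_prod_mem_bidisc (ae_weightMeasure_mem_ball μ) (ae_circleMeasure_mem_ball hR)
  mono G hG R R' hR hRR hR' :=
    lintegral_prod_mono_right (ae_weightMeasure_mem_ball μ) hG hR hRR hR'
  mass := ⟨weightMeasure μ univ, measure_ne_top _ _, fun R _ => by
    rw [leftFamily, ← univ_prod_univ, Measure.prod_prod, measure_univ (μ := circleMeasure R), mul_one]⟩

theorem isMeanFamily_rightFamily : IsMeanFamily (rightFamily μ) where
  ae_mem R hR := ae_prod_mem_bidisc (ae_circleMeasure_mem_ball hR) (ae_weightMeasure_mem_ball μ)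
  mono G hG R R' hR hRR hR' :=
    lintegral_prod_mono_left (ae_weightMeasure_mem_ball μ) hG hR hRR hR'
  mass := ⟨weightMeasure μ univ, measure_ne_top _ _, fun R _ => by
    rw [rightFamily, ← univ_prod_univ, Measure.prod_prod, measure_univ (μ := circleMeasure R), one_mul]⟩

theorem lintegral_rightFamily (G : ℂ × ℂ → ℂ) (R : ℝ) :
    ∫⁻ z, ‖G z‖ₑ ^ 2 ∂rightFamily μ R = ∫⁻ z, ‖G z.swap‖ₑ ^ 2 ∂leftFamily μ R :=
  lintegral_prod_comm _

theorem SepHol.measurable_indicator_bidisc {G : ℂ × ℂ → ℂ} (hG : SepHol G) :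
    Measurable (bidisc.indicator G) := by
  classical
  rw [← piecewise_eq_indicator]
  exact hG.continuousOn.measurable_piecewise continuousOn_const measurableSet_bidisc

theorem SepHol.lintegral_leftFamily {G : ℂ × ℂ → ℂ} (hG : SepHol G) {R : ℝ}
    (hR : R ∈ Ioo (0 : ℝ) 1) :
    ∫⁻ z, ‖G z‖ₑ ^ 2 ∂leftFamily μ R = ∫⁻ θ, ∫⁻ a, ‖G (a, circleMap 0 R θ)‖ₑ ^ 2 * weight μ a
      ∂areaMeasure ∂arcMeasure := by
  have hm := hG.measurable_indicator_bidisc.enorm.pow_const 2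
  -- `G` is arbitrary off the bidisc; cutting it off gives the measurability that Tonelli and the
  -- image measure require.
  have e1 : ∫⁻ z, ‖G z‖ₑ ^ 2 ∂leftFamily μ R =
      ∫⁻ z, ‖bidisc.indicator G z‖ₑ ^ 2 ∂leftFamily μ R := by
    refine lintegral_congr_ae ?_
    filter_upwards [(isMeanFamily_leftFamily μ).ae_mem R hR] with z hz
    rw [indicator_of_mem hz]
  rw [e1, leftFamily, lintegral_prod_symm' _ hm, lintegral_circleMeasure hm.lintegral_prod_left']
  refine lintegral_congr fun θ => ?_
  have hmθ : Measurable fun a => ‖bidisc.indicator G (a, circleMap 0 R θ)‖ₑ ^ 2 :=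
    hm.comp (measurable_id.prodMk measurable_const)
  rw [weightMeasure, lintegral_withDensity_eq_lintegral_mul _ (measurable_weight μ) hmθ]
  refine lintegral_congr_ae ?_
  filter_upwards [ae_areaMeasure_mem_ball] with a ha
  have : (a, circleMap 0 R θ) ∈ bidisc := ⟨ha, circleMap_mem_ball hR.1.le hR.2 θ⟩
  rw [Pi.mul_apply, mul_comm]
  simp [indicator_of_mem this]

theorem SepHol.lintegral_circleFamily {G : ℂ × ℂ → ℂ} (hG : SepHol G) {R : ℝ}
    (hR : R ∈ Ioo (0 : ℝ) 1) :
    ∫⁻ z, ‖G z‖ₑ ^ 2 ∂(circleMeasure R).prod (circleMeasure R) =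
      ∫⁻ θ₁, ∫⁻ θ₂, ‖G (circleMap 0 R θ₁, circleMap 0 R θ₂)‖ₑ ^ 2 ∂arcMeasure ∂arcMeasure := by
  have hm := hG.measurable_indicator_bidisc.enorm.pow_const 2
  have e1 : ∫⁻ z, ‖G z‖ₑ ^ 2 ∂(circleMeasure R).prod (circleMeasure R) =
      ∫⁻ z, ‖bidisc.indicator G z‖ₑ ^ 2 ∂(circleMeasure R).prod (circleMeasure R) := by
    refine lintegral_congr_ae ?_
    filter_upwards [isMeanFamily_circle.ae_mem R hR] with z hz
    rw [indicator_of_mem hz]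
  rw [e1, lintegral_prod _ hm.aemeasurable, lintegral_circleMeasure hm.lintegral_prod_right']
  refine lintegral_congr fun θ₁ => ?_
  have hmθ : Measurable fun b => ‖bidisc.indicator G (circleMap 0 R θ₁, b)‖ₑ ^ 2 :=
    hm.comp (measurable_const.prodMk measurable_id)
  rw [lintegral_circleMeasure hmθ]
  refine lintegral_congr fun θ₂ => ?_
  have : (circleMap 0 R θ₁, circleMap 0 R θ₂) ∈ bidisc :=
    ⟨circleMap_mem_ball hR.1.le hR.2 θ₁, circleMap_mem_ball hR.1.le hR.2 θ₂⟩
  simp [indicator_of_mem this]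

theorem hardyNormSq_eq_quad {f : ℂ × ℂ → ℂ} (hf : SepHol f) :
    hardyNormSq f = quad (fun R => (circleMeasure R).prod (circleMeasure R)) f := by
  rw [hardyNormSq, quad, iSup_subtype']
  exact iSup_congr fun R => (hf.lintegral_circleFamily R.2).symm

theorem dirichletIntegral_eq_quad (μ₁ μ₂ : Measure (closedBall (0 : ℂ) 1)) [IsFiniteMeasure μ₁]
    [IsFiniteMeasure μ₂] {f : ℂ × ℂ → ℂ} (hf : SepHol f) :
    dirichletIntegral μ₁ μ₂ f =
      quad (leftFamily μ₁) (partial₁ f) + quad (rightFamily μ₂) (partial₂ f) := by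
  rw [dirichletIntegral, quad, quad, iSup_subtype', iSup_subtype']
  congr 1
  · exact iSup_congr fun R => (hf.partial₁.lintegral_leftFamily μ₁ R.2).symm
  · refine iSup_congr fun R => ?_
    rw [lintegral_rightFamily, hf.partial₂.swap.lintegral_leftFamily μ₂ R.2]
    rfl

/-! ### Dilations contract the three terms -/

theorem ofReal_mul_circleMap (r R θ : ℝ) :
    (r : ℂ) * circleMap 0 R θ = circleMap 0 (r * R) θ := by
  simp [circleMap, mul_assoc]

theorem mul_mem_Ioo {r R : ℝ} (hr : 0 < r) (hr1 : r < 1) (hR : R ∈ Ioo (0 : ℝ) 1) :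
    r * R ∈ Ioo (0 : ℝ) 1 :=
  ⟨mul_pos hr hR.1, by nlinarith [hR.1, hR.2]⟩

/-- Dilation in the circle variable only changes the radius from `R` to `r * R`; in the disc
variable it is the weighted contraction. The factor `r` comes from the derivative of a dilate. -/
theorem quad_leftFamily_dilate_le {G : ℂ × ℂ → ℂ} (hG : SepHol G) {r : ℝ} (hr : 0 < r)
    (hr1 : r < 1) : quad (leftFamily μ) (fun z => r * dilate r G z) ≤ quad (leftFamily μ) G := by
  refine iSup_le fun R => ?_
  have hS := mul_mem_Ioo hr hr1 R.2
  refine le_trans ?_ (le_iSup (fun R : Ioo (0 : ℝ) 1 => ∫⁻ z, ‖G z‖ₑ ^ 2 ∂leftFamily μ R) ⟨_, hS⟩)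
  rw [((hG.dilate hr.le hr1.le).const_mul r).lintegral_leftFamily μ R.2,
    hG.lintegral_leftFamily μ hS]
  refine lintegral_mono fun θ => ?_
  simp only [dilate, ofReal_mul_circleMap]
  exact lintegral_weight_dilate_le μ (hG.left _ (circleMap_mem_ball hS.1.le hS.2 θ)) hr hr1

theorem quad_rightFamily_dilate_le {G : ℂ × ℂ → ℂ} (hG : SepHol G) {r : ℝ} (hr : 0 < r)
    (hr1 : r < 1) :
    quad (rightFamily μ) (fun z => r * dilate r G z) ≤ quad (rightFamily μ) G := by
  simp only [quad, lintegral_rightFamily]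
  exact quad_leftFamily_dilate_le μ hG.swap hr hr1

theorem quad_circle_dilate_le {G : ℂ × ℂ → ℂ} (hG : SepHol G) {r : ℝ} (hr : 0 < r)
    (hr1 : r < 1) : quad (fun R => (circleMeasure R).prod (circleMeasure R)) (dilate r G) ≤
      quad (fun R => (circleMeasure R).prod (circleMeasure R)) G := by
  refine iSup_le fun R => ?_
  have hS := mul_mem_Ioo hr hr1 R.2
  refine le_trans (le_of_eq ?_) (le_iSup (fun R : Ioo (0 : ℝ) 1 => ∫⁻ z, ‖G z‖ₑ ^ 2
    ∂(circleMeasure R).prod (circleMeasure R)) ⟨_, hS⟩)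
  rw [(hG.dilate hr.le hr1.le).lintegral_circleFamily R.2, hG.lintegral_circleFamily hS]
  simp only [dilate, ofReal_mul_circleMap]

theorem SepHol.tendsto_dilate {G : ℂ × ℂ → ℂ} (hG : SepHol G) {r : ℕ → ℝ}
    (hr : Tendsto r atTop (𝓝 1)) {z : ℂ × ℂ} (hz : z ∈ bidisc) :
    Tendsto (fun n => BidiscDirichlet.dilate (r n) G z) atTop (𝓝 (G z)) := by
  have hc : Tendsto (fun n => (r n : ℂ)) atTop (𝓝 1) := by
    exact_mod_cast (Complex.continuous_ofReal.tendsto 1).comp hr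
  have h : Tendsto (fun n => ((r n : ℂ) * z.1, (r n : ℂ) * z.2)) atTop (𝓝 z) := by
    simpa using (hc.mul_const z.1).prodMk_nhds (hc.mul_const z.2)
  exact (hG.continuousOn.continuousAt (isOpen_bidisc.mem_nhds hz)).tendsto.comp h

/-! ### Membership and density of the polynomials -/

theorem exists_polyFun_eq_dilate_half (p : MvPolynomial (Fin 2) ℂ) :
    ∃ q, polyFun p = dilate (1 / 2) (polyFun q) := by
  obtain ⟨q, hq⟩ := exists_polyFun_eq_dilate 2 p
  refine ⟨q, ?_⟩
  rw [hq]
  ext z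
  simp [dilate]

/-- `SepHol` bounds functions only on smaller bidiscs, so write `p` as the dilate by `1 / 2` of
another polynomial. -/
theorem exists_norm_polyFun_le (p : MvPolynomial (Fin 2) ℂ) :
    ∃ M : ℝ, ∀ z ∈ bidisc, ‖polyFun p z‖ ≤ M ∧ ‖partial₁ (polyFun p) z‖ ≤ M ∧
      ‖partial₂ (polyFun p) z‖ ≤ M := by
  obtain ⟨q, hq⟩ := exists_polyFun_eq_dilate_half p
  have hs := sepHol_polyFun q
  have half : (1 / 2 : ℝ) < 1 := by norm_num
  obtain ⟨M, hM⟩ := hs.bdd _ half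
  obtain ⟨M₁, hM₁⟩ := hs.partial₁.bdd _ half
  obtain ⟨M₂, hM₂⟩ := hs.partial₂.bdd _ half
  have aux : ∀ w ∈ ball (0 : ℂ) 1, ‖((1 / 2 : ℝ) : ℂ) * w‖ ≤ 1 / 2 := fun w hw => by
    rw [norm_mul, Complex.norm_of_nonneg (by norm_num)]
    exact mul_le_of_le_one_right (by norm_num) (mem_ball_zero_iff.1 hw).le
  refine ⟨max M (max M₁ M₂), fun z hz => ?_⟩
  have h0 := hM _ _ (aux _ hz.1) (aux _ hz.2)
  have h1 := hM₁ _ _ (aux _ hz.1) (aux _ hz.2)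
  have h2 := hM₂ _ _ (aux _ hz.1) (aux _ hz.2)
  rw [hq, partial₁_dilate, partial₂_dilate, norm_mul, norm_mul,
    Complex.norm_of_nonneg (by norm_num : (0 : ℝ) ≤ 1 / 2)]
  exact ⟨h0.trans (le_max_left _ _),
    (mul_le_of_le_one_left (norm_nonneg _) half.le).trans
      (h1.trans ((le_max_left _ _).trans (le_max_right _ _))),
    (mul_le_of_le_one_left (norm_nonneg _) half.le).trans
      (h2.trans ((le_max_right _ _).trans (le_max_right _ _)))⟩

theorem polyFun_mem_dirichletSpace (μ₁ μ₂ : Measure (closedBall (0 : ℂ) 1)) [IsFiniteMeasure μ₁]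
    [IsFiniteMeasure μ₂] (p : MvPolynomial (Fin 2) ℂ) : polyFun p ∈ dirichletSpace μ₁ μ₂ := by
  have hs := sepHol_polyFun p
  obtain ⟨M, hM⟩ := exists_norm_polyFun_le p
  have fin : ∀ m : ℝ → Measure (ℂ × ℂ), IsMeanFamily m → ∀ G : ℂ × ℂ → ℂ,
      (∀ z ∈ bidisc, ‖G z‖ ≤ M) → quad m G < ⊤ := fun m hm G hG => by
    obtain ⟨C, hC, h⟩ := hm.exists_quad_le
    exact (h G M hG).trans_lt
      (ENNReal.mul_lt_top (ENNReal.pow_lt_top ENNReal.ofReal_lt_top) hC.lt_top)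
  refine ⟨⟨(differentiable_polyFun p).differentiableOn, ?_⟩, ?_⟩
  · rw [hardyNormSq_eq_quad hs]
    exact fin _ isMeanFamily_circle _ fun z hz => (hM z hz).1
  · rw [dirichletIntegral_eq_quad μ₁ μ₂ hs]
    exact ENNReal.add_lt_top.2 ⟨fin _ (isMeanFamily_leftFamily μ₁) _ fun z hz => (hM z hz).2.1,
      fin _ (isMeanFamily_rightFamily μ₂) _ fun z hz => (hM z hz).2.2⟩

/-- Distances in a mean family: `G` is near `H`, which is uniformly near `K`. -/
theorem IsMeanFamily.quad_sub_le {m : ℝ → Measure (ℂ × ℂ)} (hm : IsMeanFamily m)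
    {F G H : ℂ × ℂ → ℂ} (hG : SepHol G) (hH : SepHol H) (hF : EqOn F (G + H) bidisc) {δ : ℝ≥0∞}
    (h1 : quad m G ≤ δ) (h2 : quad m H ≤ δ) : quad m F ≤ 4 * δ := by
  rw [hm.quad_congr hF]
  calc _ ≤ 2 * quad m G + 2 * quad m H := hm.quad_add_le hG hH
    _ ≤ 2 * δ + 2 * δ := by gcongr
    _ = 4 * δ := by ring

theorem exists_pos_ofReal_sq_mul_le {C : ℝ≥0∞} (hC : C ≠ ⊤) {δ : ℝ} (hδ : 0 < δ) :
    ∃ η : ℝ, 0 < η ∧ ENNReal.ofReal η ^ 2 * C ≤ ENNReal.ofReal δ := by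
  have hC0 : 0 ≤ C.toReal := ENNReal.toReal_nonneg
  refine ⟨√(δ / (C.toReal + 1)), Real.sqrt_pos.2 (by positivity), ?_⟩
  rw [← ENNReal.ofReal_pow (Real.sqrt_nonneg _), Real.sq_sqrt (by positivity),
    ← ENNReal.ofReal_toReal hC, ← ENNReal.ofReal_mul (by positivity),
    ENNReal.toReal_ofReal hC0]
  refine ENNReal.ofReal_le_ofReal ?_
  rw [div_mul_eq_mul_div, div_le_iff₀ (by positivity)]
  nlinarith

theorem exists_polyFun_dirichletNorm_lt (μ₁ μ₂ : Measure (closedBall (0 : ℂ) 1))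
    [IsFiniteMeasure μ₁] [IsFiniteMeasure μ₂] {f : ℂ × ℂ → ℂ} (hf : f ∈ dirichletSpace μ₁ μ₂)
    {ε : ℝ} (hε : 0 < ε) :
    ∃ p, dirichletNorm μ₁ μ₂ (f - polyFun p) < ENNReal.ofReal ε := by
  obtain ⟨⟨hd, hfin0⟩, hfin⟩ := hf
  have hs := sepHol_of_differentiableOn hd
  rw [hardyNormSq_eq_quad hs] at hfin0
  rw [dirichletIntegral_eq_quad μ₁ μ₂ hs, ENNReal.add_lt_top] at hfin
  have hm0 := isMeanFamily_circle
  have hm1 := isMeanFamily_leftFamily μ₁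
  have hm2 := isMeanFamily_rightFamily μ₂
  -- The shift by `2` keeps every `r n` positive, including `r 0 = 1 / 2`.
  set r : ℕ → ℝ := fun n => 1 - 1 / ((n : ℝ) + 2) with hrdef
  have hr0 : ∀ n, 0 < r n := fun n => by
    have : (0 : ℝ) ≤ n := n.cast_nonneg
    rw [hrdef]
    simp only [sub_pos]
    rw [div_lt_one (by positivity)]
    linarith
  have hr1 : ∀ n, r n < 1 := fun n => sub_lt_self _ (by positivity)
  have hr : Tendsto r atTop (𝓝 1) := by
    have h := (tendsto_const_div_atTop_nhds_zero_nat (1 : ℝ)).comp (tendsto_add_atTop_nat 2)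
    have h' := h.const_sub 1
    rw [sub_zero] at h'
    refine h'.congr fun n => ?_
    simp [hrdef]
  have hrc : Tendsto (fun n => (r n : ℂ)) atTop (𝓝 1) := by
    exact_mod_cast (Complex.continuous_ofReal.tendsto 1).comp hr
  have hdil : ∀ n, SepHol (dilate (r n) f) := fun n => hs.dilate (hr0 n).le (hr1 n).le
  have e1 : ∀ n, partial₁ (dilate (r n) f) = fun z => r n * dilate (r n) (partial₁ f) z :=
    fun n => funext fun z => partial₁_dilate (r n) f z
  have e2 : ∀ n, partial₂ (dilate (r n) f) = fun z => r n * dilate (r n) (partial₂ f) z :=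
    fun n => funext fun z => partial₂_dilate (r n) f z
  -- Each of the three terms will cost `4 * δ`, in total `12 * δ < ε ^ 2`.
  set δ : ℝ := ε ^ 2 / 16 with hδdef
  have hδ : 0 < δ := by positivity
  have hδ' : ENNReal.ofReal δ ≠ 0 := by simpa using hδ
  have c0 := hm0.eventually_quad_sub_le hs hdil (fun z hz => hs.tendsto_dilate hr hz)
    (fun n => quad_circle_dilate_le hs (hr0 n) (hr1 n)) hfin0.ne hδ'
  have c1 := hm1.eventually_quad_sub_le hs.partial₁ (fun n => (hdil n).partial₁)
    (fun z hz => by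
      simp only [e1]
      simpa using hrc.mul (hs.partial₁.tendsto_dilate hr hz))
    (fun n => by rw [e1]; exact quad_leftFamily_dilate_le μ₁ hs.partial₁ (hr0 n) (hr1 n))
    hfin.1.ne hδ'
  have c2 := hm2.eventually_quad_sub_le hs.partial₂ (fun n => (hdil n).partial₂)
    (fun z hz => by
      simp only [e2]
      simpa using hrc.mul (hs.partial₂.tendsto_dilate hr hz))
    (fun n => by rw [e2]; exact quad_rightFamily_dilate_le μ₂ hs.partial₂ (hr0 n) (hr1 n))
    hfin.2.ne hδ'
  obtain ⟨n, h0, h1, h2⟩ := (c0.and (c1.and c2)).exists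
  obtain ⟨C₀, hC₀, b0⟩ := hm0.exists_quad_le
  obtain ⟨C₁, hC₁, b1⟩ := hm1.exists_quad_le
  obtain ⟨C₂, hC₂, b2⟩ := hm2.exists_quad_le
  obtain ⟨η, hη, hηle⟩ := exists_pos_ofReal_sq_mul_le
    (C := C₀ + (C₁ + C₂)) (by finiteness) hδ
  obtain ⟨p, hp⟩ := hs.exists_polyFun_near_dilate (hr0 n).le (hr1 n) hη
  have hps := sepHol_polyFun p
  have k0 := (b0 _ η fun z hz => (hp z hz).1).trans
    ((mul_le_mul_right le_self_add _).trans hηle)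
  have k1 := (b1 _ η fun z hz => (hp z hz).2.1).trans
    ((mul_le_mul_right (le_self_add.trans le_add_self) _).trans hηle)
  have k2 := (b2 _ η fun z hz => (hp z hz).2.2).trans
    ((mul_le_mul_right (le_add_self.trans le_add_self) _).trans hηle)
  have hdp := (hdil n).sub hps
  -- Each term is split through the dilate: `f - p = (f - f_r) + (f_r - p)`.
  have q0 := hm0.quad_sub_le (F := f - polyFun p) (hs.sub (hdil n)) hdp
    (fun z _ => by simp) h0 k0
  have q1 := hm1.quad_sub_le (F := partial₁ (f - polyFun p)) (hs.partial₁.sub (hdil n).partial₁)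
    hdp.partial₁ (fun z hz => by
      simp [partial₁_sub hs hps hz, partial₁_sub (hdil n) hps hz]) h1 k1
  have q2 := hm2.quad_sub_le (F := partial₂ (f - polyFun p)) (hs.partial₂.sub (hdil n).partial₂)
    hdp.partial₂ (fun z hz => by
      simp [partial₂_sub hs hps hz, partial₂_sub (hdil n) hps hz]) h2 k2
  refine ⟨p, ?_⟩
  rw [dirichletNorm, hardyNormSq_eq_quad (hs.sub hps),
    dirichletIntegral_eq_quad μ₁ μ₂ (hs.sub hps)]
  have hsum := add_le_add q0 (add_le_add q1 q2)
  have h12 : 4 * ENNReal.ofReal δ + (4 * ENNReal.ofReal δ + 4 * ENNReal.ofReal δ) <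
      ENNReal.ofReal (ε ^ 2) := by
    have : 4 * ENNReal.ofReal δ + (4 * ENNReal.ofReal δ + 4 * ENNReal.ofReal δ) =
        ENNReal.ofReal (12 * δ) := by
      rw [ENNReal.ofReal_mul (by norm_num), ENNReal.ofReal_ofNat]
      ring
    rw [this]
    refine (ENNReal.ofReal_lt_ofReal_iff (by positivity)).2 ?_
    rw [hδdef]
    nlinarith [sq_pos_of_pos hε]
  calc _ < ENNReal.ofReal (ε ^ 2) ^ (1 / 2 : ℝ) :=
        ENNReal.rpow_lt_rpow (hsum.trans_lt h12) (by norm_num)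
    _ = ENNReal.ofReal ε := by
      rw [ENNReal.ofReal_rpow_of_nonneg (by positivity) (by norm_num), ← Real.sqrt_eq_rpow,
        Real.sqrt_sq hε.le]

end BidiscDirichlet

end

/-- The polynomials lie in `D(μ₁, μ₂)` and are dense in it with respect to its norm. -/
theorem mainTheorem7 (μ₁ μ₂ : MeasureTheory.Measure (Metric.closedBall (0 : ℂ) 1))
    [MeasureTheory.IsFiniteMeasure μ₁] [MeasureTheory.IsFiniteMeasure μ₂] :
    (∀ p : MvPolynomial (Fin 2) ℂ,
      BidiscDirichlet.polyFun p ∈ BidiscDirichlet.dirichletSpace μ₁ μ₂) ∧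
    ∀ f ∈ BidiscDirichlet.dirichletSpace μ₁ μ₂, ∀ ε : ℝ, 0 < ε →
      ∃ p : MvPolynomial (Fin 2) ℂ,
        BidiscDirichlet.dirichletNorm μ₁ μ₂ (f - BidiscDirichlet.polyFun p) <
          ENNReal.ofReal ε :=
  ⟨BidiscDirichlet.polyFun_mem_dirichletSpace μ₁ μ₂, fun _ hf _ hε =>
    BidiscDirichlet.exists_polyFun_dirichletNorm_lt μ₁ μ₂ hf hε⟩
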